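/- Let $T$ be a tree (a connected graph without cycles, of any cardinality). An embedding of $T$ is an injective map $f:V(T)\to V(T)$ such that $x,y$ are adjacent if and only if $f(x),f(y)$ are adjacent. A ray is a one-way infinite path; two rays are equivalent if their vertex sets agree outside a finite set, and the ends of $T$ are the equivalence classes of rays. $T$ is scattered if no subdivision of the binary tree (the tree of finite $0$-$1$ sequences, each sequence being adjacent to its two one-entry extensions) embeds into $T$. The set $\Omega(T)$ of ends carries the topology with basis the sets $\Omega_{r,s}$ ($s\in V(T)$), where $r$ is a fixed vertex and $\Omega_{r,s}$ is the set of ends whose ray starting at $r$ contains $s$; the topology does not depend on $r$. The order of an end $e$ is the least ordinal $\alpha$ such that $e$ does not belong to the $(\alpha+1)$-st Cantor–Bendixson derivative of $\Omega(T)$. An end is of maximal order if it has an order and its order is at least the order of every other end. An end $e$ is preserved forward (respectively backward) by an embedding $f$ if $f[C]\subseteq C$ (respectively $C\subseteq f[C]$) for some ray $C\in e$; it is almost rigid if every embedding of $T$ preserves it both forward and backward. A ray $C$ is preserved by $f$ if $f[C]\subseteq C$. For a ray $C=\{x_0,x_1,\dots\}$ let $T_{x_i}$ be the tree rooted at $x_i$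 whose vertex set is the connected component of $x_i$ in $T\setminus\{x_{i-1},x_{i+1}\}$ (in $T\setminus\{x_1\}$ if $i=0$). The ray $C$ is regular if, up to equimorphy (mutual embeddability by embeddings sending root to root), there are only finitely many rooted trees $T_{x_i}$. An end is regular if it contains a regular ray. **Theorem 1.3.** 1. If $T$ is scattered and contains exactly one end $e$ of maximal order, then $e$ is preserved forward by every embedding of $T$. 2. If $e$ is a regular end of $T$ which is preserved forward by every embedding of $T$, and if $T$ is scattered or $e$ is not almost rigid, then $e$ contains a ray that is preserved by every embedding of $T$. -/

import Mathlib

universe u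

namespace TreeEmb

/-! ### Subdivisions, the binary tree, scattered trees -/

/-- `S` is a subdivision of `H`: there are distinct branch vertices `φ a` of `S`, one for each
vertex `a` of `H`, and for each edge `ab` of `H` a path `P a b` of `S` from `φ a` to `φ b`
(the same path, reversed, for `b a`), such that these paths are internally disjoint from each
other and from the branch vertices, and `S` has no further vertices and no further edges. -/
def IsSubdivision {W X : Type*} (H : SimpleGraph W) (S : SimpleGraph X) : Prop :=
  ∃ (φ : W ↪ X) (P : ∀ a b : W, H.Adj a b → S.Walk (φ a) (φ b)),
    (∀ a b h, (P a b h).IsPath) ∧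
    (∀ a b (h : H.Adj a b), P b a h.symm = (P a b h).reverse) ∧
    (∀ a b h c, φ c ∈ (P a b h).support → c = a ∨ c = b) ∧
    (∀ a b h a' b' h' x, x ∈ (P a b h).support → x ∈ (P a' b' h').support →
      s(a, b) = s(a', b') ∨ x ∈ Set.range φ) ∧
    (∀ x, x ∈ Set.range φ ∨ ∃ a b h, x ∈ (P a b h).support) ∧
    (∀ x y, S.Adj x y → ∃ a b h, s(x, y) ∈ (P a b h).edges)

/-- The binary (dyadic) tree: its vertices are the finite `0`-`1` sequences, and each sequence `s`
is adjacent to the two sequences obtained by adding one entry on the right of `s`. -/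
def binaryTree : SimpleGraph (List Bool) :=
  SimpleGraph.fromRel fun s t => ∃ i : Bool, t = s ++ [i]

/-- No subdivision of the binary tree is embeddable into `T`. (A subdivision that embeds into `T`
is isomorphic to one on a set of vertices of `T`, so one universe level is enough.) -/
def IsScattered {V : Type u} (T : SimpleGraph V) : Prop :=
  ∀ (X : Type u) (S : SimpleGraph X), IsSubdivision binaryTree S → IsEmpty (S ↪g T)

/-! ### Rays and ends -/

/-- A ray (one-way infinite path) of `T`, given by its vertices `x₀, x₁, x₂, …` listed from its
origin. -/
structure Ray {V : Type u} (T : SimpleGraph V) where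
  /-- the `n`-th vertex -/
  vertex : ℕ → V
  injective : Function.Injective vertex
  adj : ∀ n, T.Adj (vertex n) (vertex (n + 1))

namespace Ray

variable {V : Type u} {T : SimpleGraph V}

/-- The vertex set of a ray. -/
def verts (C : Ray T) : Set V := Set.range C.vertex

/-- Two rays are equivalent if their vertex sets agree outside some finite set of vertices. -/
def Equivalent (C C' : Ray T) : Prop :=
  ∃ F : Set V, F.Finite ∧ C.verts \ F = C'.verts \ F

variable (T) in
theorem equivalent_equivalence : Equivalence (Equivalent (T := T)) where
  refl _ := ⟨∅, Set.finite_empty, rfl⟩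
  symm := fun ⟨F, hF, h⟩ => ⟨F, hF, h.symm⟩
  trans := by
    rintro A B C ⟨F, hF, h⟩ ⟨G, hG, h'⟩
    refine ⟨F ∪ G, hF.union hG, ?_⟩
    rw [← Set.sdiff_sdiff, h, Set.sdiff_sdiff, Set.union_comm, ← Set.sdiff_sdiff, h', Set.sdiff_sdiff]

variable (T) in
/-- The setoid of equivalence of rays. -/
def setoid : Setoid (Ray T) := ⟨Equivalent, equivalent_equivalence T⟩

end Ray

/-- The ends of `T`: the equivalence classes of rays. -/
def TreeEnd {V : Type u} (T : SimpleGraph V) : Type u := Quotient (Ray.setoid T)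

/-- The end to which a ray belongs. -/
def Ray.toEnd {V : Type u} {T : SimpleGraph V} (C : Ray T) : TreeEnd T :=
  Quotient.mk (Ray.setoid T) C

/-! ### Embeddings and ends -/

section Embeddings

variable {V : Type u} {T : SimpleGraph V}

/-- The embedding `f` of `T` preserves the ray `C`, that is `f[C] ⊆ C`. -/
def Ray.PreservedBy (C : Ray T) (f : T ↪g T) : Prop := f '' C.verts ⊆ C.verts

/-- The end `e` is preserved forward by `f`: `f[C] ⊆ C` for some ray `C ∈ e`. -/
def TreeEnd.PreservedForwardBy (e : TreeEnd T) (f : T ↪g T) : Prop :=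
  ∃ C : Ray T, C.toEnd = e ∧ f '' C.verts ⊆ C.verts

/-- The end `e` is preserved backward by `f`: `C ⊆ f[C]` for some ray `C ∈ e`. -/
def TreeEnd.PreservedBackwardBy (e : TreeEnd T) (f : T ↪g T) : Prop :=
  ∃ C : Ray T, C.toEnd = e ∧ C.verts ⊆ f '' C.verts

/-- The end `e` is almost rigid: it is preserved backward and forward by every embedding. -/
def TreeEnd.IsAlmostRigid (e : TreeEnd T) : Prop :=
  ∀ f : T ↪g T, e.PreservedBackwardBy f ∧ e.PreservedForwardBy f

end Embeddings

/-! ### Regular rays and regular ends -/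

/-- The rooted tree `(G, r)` embeds into the rooted tree `(G', r')`. -/
def RootedEmbeds {A B : Type*} (G : SimpleGraph A) (r : A) (G' : SimpleGraph B) (r' : B) : Prop :=
  ∃ g : G ↪g G', g r = r'

section Regular

variable {V : Type u} {T : SimpleGraph V}

/-- For `x ∉ X`, the vertex set of the connected component of `x` in `T ∖ X`. -/
def componentAvoiding (T : SimpleGraph V) (X : Set V) (x : V) : Set V :=
  {y | ∃ p : T.Walk x y, ∀ v ∈ p.support, v ∉ X}

namespace Ray

/-- The neighbours of `x_i` on the ray `x₀, x₁, …`: these are `x_{i-1}` and `x_{i+1}` if `i ≥ 1`,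
and `x_1` only if `i = 0`. -/
def neighbours (C : Ray T) (i : ℕ) : Set V :=
  {v | v = C.vertex (i + 1) ∨ ∃ j, j + 1 = i ∧ v = C.vertex j}

/-- The vertex set of the tree `T_{x_i}` attached to the ray at `x_i`: the connected component of
`x_i` in `T ∖ {x_{i-1}, x_{i+1}}` if `i ≥ 1`, and in `T ∖ {x_1}` if `i = 0`. -/
def piece (C : Ray T) (i : ℕ) : Set V := componentAvoiding T (C.neighbours i) (C.vertex i)

theorem vertex_mem_piece (C : Ray T) (i : ℕ) : C.vertex i ∈ C.piece i := by
  refine ⟨SimpleGraph.Walk.nil, ?_⟩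
  intro v hv
  rw [SimpleGraph.Walk.support_nil, List.mem_singleton] at hv
  subst hv
  rintro (h | ⟨j, hj, h⟩)
  · have := C.injective h
    omega
  · have := C.injective h
    omega

/-- The rooted tree `(T_{x_i}, x_i)` embeds into the rooted tree `(T_{x_j}, x_j)`. -/
def PieceEmbeds (C : Ray T) (i j : ℕ) : Prop :=
  RootedEmbeds (T.induce (C.piece i)) ⟨C.vertex i, C.vertex_mem_piece i⟩
    (T.induce (C.piece j)) ⟨C.vertex j, C.vertex_mem_piece j⟩

/-- A ray is regular if there are only finitely many rooted trees `(T_{x_i}, x_i)` up to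
equimorphy (embeddability in both directions). -/
def IsRegular (C : Ray T) : Prop :=
  ∃ F : Finset ℕ, ∀ i, ∃ j ∈ F, C.PieceEmbeds i j ∧ C.PieceEmbeds j i

end Ray

/-- An end is regular if it contains some regular ray. -/
def TreeEnd.IsRegular (e : TreeEnd T) : Prop := ∃ C : Ray T, C.toEnd = e ∧ C.IsRegular

end Regular

/-! ### The space of ends and the order of an end -/

section Order

variable {V : Type u} {T : SimpleGraph V}

/-- The ends `e` such that the ray starting at `r` and belonging to `e` contains `s`. -/
def endsThrough (T : SimpleGraph V) (r s : V) : Set (TreeEnd T) :=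
  {e | ∃ C : Ray T, C.toEnd = e ∧ C.vertex 0 = r ∧ s ∈ C.verts}

/-- The topology of the space of ends of a tree. For each single vertex `r`, the sets
`endsThrough T r s` form a basis of a topology, which does not depend on `r`; so all of them
together generate that same topology. -/
instance : TopologicalSpace (TreeEnd T) :=
  TopologicalSpace.generateFrom {U | ∃ r s : V, U = endsThrough T r s}

/-- The end `e` has order (rank) `α`: `α` is the least ordinal such that `e` does not belong to
the `(α + 1)`-st Cantor-Bendixson derivative of the space of ends. -/
def TreeEnd.HasOrder (e : TreeEnd T) (α : Ordinal.{u}) : Prop :=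
  IsLeast {β : Ordinal.{u} |
    e ∉ CantorBendixson.iteratedDerivedSet (Set.univ : Set (TreeEnd T)) (β + 1)} α

/-- The order of `e` is at least the order of every other end. -/
def TreeEnd.HasMaximalOrder (e : TreeEnd T) : Prop :=
  ∃ α, e.HasOrder α ∧ ∀ e' : TreeEnd T, ∀ β, e'.HasOrder β → β ≤ α

end Order

end TreeEmb

namespace TreeEmb

variable {V : Type u} {T : SimpleGraph V}

/-! ### Distances in a tree -/

/-! In a tree an embedding is the same thing as a distance-preserving map, and cutting at an edge
makes distances additive (`dist_add_dist`). Two rays of the same end share a tail (`toEnd_eq_iff`),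
so an embedding that fixes an end eventually acts on a given ray of it as a shift, forwards or
backwards.

Unique end of maximal order. An embedding `f` acts injectively on ends and respects every
Cantor–Bendixson derivative, so it must fix the end `e`. If it shifted a ray `x₀, x₁, …` of `e`
backwards, the images of the ray would extend it to a double ray. Its other end is fixed by `f`, and
iterates of `f` push any suitable end towards it, so it lies in every derivative that contains `e`
(`oppositeRay_mem`). It would be a second end of maximal order.

Common preserved ray. Here every embedding shifts a regular ray `C` forwards by some `l ≥ 0`, but
the place from which it does so might depend on the embedding. If no tail of `C` works for all
embeddings, there are embeddings whose last failure index `M` is arbitrarily large. At `x_{M+1}`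
such an embedding throws the branch containing the origin off the ray.

If some shift is positive, regularity makes the pieces eventually periodic up to equimorphy. The
parts `back n` then increase strictly along a residue class, since an embedding from a later one to
an earlier one would glue with the pieces to a backward shift (`not_backEmb`). Transporting the
thrown branches to one fixed vertex produces an infinite increasing chain of branches off the ray
there (`LastFailure.chain_or_between`). Moving each branch of the chain to the next makes room for
the branch of the origin (`emb_back_piece`), and this contradicts strictness.

If all shifts are zero and the tree is scattered, the thrown branch can be copied to two different
vertices of the ray. One part `back M` then contains two incomparable rooted copies of itself, and
iterating gives a subdivided binary tree. If all shifts are zero, the end is almost rigid, which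
covers the remaining case. -/

theorem dist_of_isPath (hT : T.IsTree) {u v : V} {p : T.Walk u v} (hp : p.IsPath) :
    p.length = T.dist u v := by
  obtain ⟨q, hq, hl⟩ := hT.connected.exists_path_of_dist u v
  rw [← hl, (hT.existsUnique_path u v).unique hp hq]

theorem dist_embedding (hT : T.IsTree) (f : T ↪g T) (u v : V) :
    T.dist (f u) (f v) = T.dist u v := by
  obtain ⟨q, hq, hl⟩ := hT.connected.exists_path_of_dist u v
  have h := dist_of_isPath hT (hq.map (f := f.toHom) f.injective)
  rw [SimpleGraph.Walk.length_map] at h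
  rw [← hl, h]
  rfl

theorem dist_eq_zero (hT : T.IsTree) {u v : V} : T.dist u v = 0 ↔ u = v :=
  hT.connected.dist_eq_zero_iff

theorem dist_adj_cases (hT : T.IsTree) (w : V) {u v : V} (h : T.Adj u v) :
    T.dist w u = T.dist w v + 1 ∨ T.dist w v = T.dist w u + 1 :=
  hT.dist_eq_dist_add_one_of_adj w h

theorem exists_closer (hT : T.IsTree) {u w : V} (h : u ≠ w) :
    ∃ v, T.Adj u v ∧ T.dist w u = T.dist w v + 1 := by
  obtain ⟨p, hp, hl⟩ := hT.connected.exists_path_of_dist u w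
  cases p with
  | nil => exact absurd rfl h
  | @cons _ v _ hadj q =>
    refine ⟨v, hadj, ?_⟩
    have h1 := SimpleGraph.dist_le q
    rw [SimpleGraph.Walk.length_cons] at hl
    rw [SimpleGraph.dist_comm (u := w) (v := u), SimpleGraph.dist_comm (u := w) (v := v)]
    rcases dist_adj_cases hT w hadj with h2 | h2 <;>
      rw [SimpleGraph.dist_comm (u := w) (v := u), SimpleGraph.dist_comm (u := w) (v := v)] at h2 <;>
      omega

theorem closer_unique (hT : T.IsTree) {u v v' w : V} (h : T.Adj u v) (h' : T.Adj u v')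
    (hd : T.dist w u = T.dist w v + 1) (hd' : T.dist w u = T.dist w v' + 1) : v = v' := by
  obtain ⟨p, hp, hl⟩ := hT.connected.exists_path_of_dist v w
  obtain ⟨p', hp', hl'⟩ := hT.connected.exists_path_of_dist v' w
  have e : ∀ {x : V} (hx : T.Adj u x) (q : T.Walk x w) (_ : q.length = T.dist x w)
      (_ : T.dist w u = T.dist w x + 1), (SimpleGraph.Walk.cons hx q).IsPath := by
    intro x hx q hq hd
    apply SimpleGraph.Walk.isPath_of_length_eq_dist
    rw [SimpleGraph.Walk.length_cons, hq, SimpleGraph.dist_comm (u := u), hd,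
      SimpleGraph.dist_comm]
  have := (hT.existsUnique_path u w).unique (e h p hl hd) (e h' p' hl' hd')
  injection this

/-- The side of `v` in the tree cut at the edge `uv`. -/
def half (T : SimpleGraph V) (u v : V) : Set V := {w | T.dist w u = T.dist w v + 1}

theorem mem_half {u v w : V} : w ∈ half T u v ↔ T.dist w u = T.dist w v + 1 := Iff.rfl

theorem half_or (hT : T.IsTree) {u v : V} (h : T.Adj u v) (w : V) :
    w ∈ half T u v ∨ w ∈ half T v u := dist_adj_cases hT w h

theorem not_mem_half {u v w : V} (h : w ∈ half T u v) : w ∉ half T v u := by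
  simp only [mem_half] at *; omega

theorem dist_adj {u v : V} (h : T.Adj u v) : T.dist u v = 1 :=
  SimpleGraph.dist_eq_one_iff_adj.2 h

/-- Induction on the distance of `b` from the edge. If the step from `b'` out to `b` brought one
nearer to `a`, then `b'` would have two neighbours nearer to `a`: `b`, and the next vertex back
towards the edge. -/
theorem dist_add_dist (hT : T.IsTree) {u v a b : V} (h : T.Adj u v) (ha : a ∈ half T v u)
    (hb : b ∈ half T u v) : T.dist a b = T.dist a u + 1 + T.dist v b := by
  induction hn : T.dist v b using Nat.strong_induction_on generalizing b with
  | _ n ih =>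
    rw [mem_half] at ha hb
    by_cases hbv : b = v
    · subst hbv
      rw [SimpleGraph.dist_self] at hn
      omega
    obtain ⟨b', hbb, hd⟩ := exists_closer hT hbv
    have hbu := dist_adj_cases hT u hbb
    have hvb := dist_adj_cases hT b' h
    have hab := dist_adj_cases hT a hbb
    rw [SimpleGraph.dist_comm (u := b), SimpleGraph.dist_comm (u := b)] at hb
    rw [SimpleGraph.dist_comm (u := b'), SimpleGraph.dist_comm (u := b') (v := v)] at hvb
    have hb' : b' ∈ half T u v := by
      rw [mem_half, SimpleGraph.dist_comm, SimpleGraph.dist_comm (u := b') (v := v)]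
      omega
    have h1 := ih (T.dist v b') (by omega) hb' rfl
    rcases hab with hab | hab
    · omega
    exfalso
    by_cases hbv' : b' = v
    · subst hbv'
      have := closer_unique hT hbb.symm h.symm hab ha
      subst this
      rw [SimpleGraph.dist_self] at hb
      omega
    obtain ⟨b'', hbb', hd'⟩ := exists_closer hT hbv'
    have hbu' := dist_adj_cases hT u hbb'
    have hvb' := dist_adj_cases hT b'' h
    rw [SimpleGraph.dist_comm (u := b''), SimpleGraph.dist_comm (u := b'') (v := v)] at hvb'
    rw [mem_half, SimpleGraph.dist_comm, SimpleGraph.dist_comm (u := b') (v := v)] at hb'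
    have hb'' : b'' ∈ half T u v := by
      rw [mem_half, SimpleGraph.dist_comm, SimpleGraph.dist_comm (u := b'') (v := v)]
      omega
    have h2 := ih (T.dist v b'') (by omega) hb'' rfl
    have := closer_unique hT hbb' hbb.symm (w := a) (by omega) hab
    subst this
    omega

theorem left_mem_half {u v : V} (h : T.Adj u v) : u ∈ half T v u := by
  rw [mem_half, dist_adj h, SimpleGraph.dist_self]

theorem right_mem_half {u v : V} (h : T.Adj u v) : v ∈ half T u v := left_mem_half h.symm

/-- Distinct branches at `x` are disjoint because only one neighbour of `x` can be nearer to `w`. -/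
theorem half_disjoint_of_ne (hT : T.IsTree) {x y y' w : V} (h : T.Adj x y) (h' : T.Adj x y')
    (hne : y ≠ y') (hw : w ∈ half T x y) : w ∈ half T y' x := by
  rcases half_or hT h' w with h1 | h1
  · exact absurd (closer_unique hT h h' hw h1) hne
  · exact h1

theorem half_subset (hT : T.IsTree) {x y y' : V} (h : T.Adj x y) (h' : T.Adj x y')
    (hne : y ≠ y') : half T x y ⊆ half T y' x := fun _ => half_disjoint_of_ne hT h h' hne

theorem dist_branches (hT : T.IsTree) {x y u v : V} (h : T.Adj x y)
    (hu : u ∈ half T x y) (hv : v ∈ half T y x) : T.dist u v = T.dist u x + T.dist x v := by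
  have := dist_add_dist hT h.symm hu hv
  rw [mem_half] at hu
  omega

/-- Vertices of a geodesic are exactly the vertices in between. -/
theorem mem_support_iff (hT : T.IsTree) {u v x : V} {p : T.Walk u v} (hp : p.IsPath) :
    x ∈ p.support ↔ T.dist u x + T.dist x v = T.dist u v := by
  classical
  constructor
  · intro hx
    have h := congrArg SimpleGraph.Walk.length (p.take_spec hx)
    rw [SimpleGraph.Walk.length_append, dist_of_isPath hT hp, dist_of_isPath hT (hp.takeUntil hx),
      dist_of_isPath hT (hp.dropUntil hx)] at h
    exact h
  · intro h
    obtain ⟨p1, -, h1⟩ := hT.connected.exists_path_of_dist u x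
    obtain ⟨p2, -, h2⟩ := hT.connected.exists_path_of_dist x v
    have h3 : (p1.append p2).IsPath := by
      apply SimpleGraph.Walk.isPath_of_length_eq_dist
      rw [SimpleGraph.Walk.length_append]; omega
    rw [(hT.existsUnique_path u v).unique hp h3, SimpleGraph.Walk.mem_support_append_iff]
    exact Or.inl p1.end_mem_support

theorem mem_edges_of_dist (hT : T.IsTree) {u v x y : V} {p : T.Walk u v} (hp : p.IsPath)
    (hxy : T.Adj x y) (h : T.dist u x + 1 + T.dist y v = T.dist u v) : s(x, y) ∈ p.edges := by
  obtain ⟨p1, -, h1⟩ := hT.connected.exists_path_of_dist u x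
  obtain ⟨p2, -, h2⟩ := hT.connected.exists_path_of_dist y v
  have h3 : (p1.append (SimpleGraph.Walk.cons hxy p2)).IsPath := by
    apply SimpleGraph.Walk.isPath_of_length_eq_dist
    rw [SimpleGraph.Walk.length_append, SimpleGraph.Walk.length_cons]; omega
  rw [(hT.existsUnique_path u v).unique hp h3, SimpleGraph.Walk.edges_append,
    SimpleGraph.Walk.edges_cons]
  simp

/-! ### The order of the tree rooted at `r` -/

/-- `u` lies on the path from `r` to `v`. -/
def Below (T : SimpleGraph V) (r u v : V) : Prop := T.dist r u + T.dist u v = T.dist r v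

theorem below_refl (r u : V) : Below T r u u := by
  rw [Below, SimpleGraph.dist_self, add_zero]

theorem below_root (r v : V) : Below T r r v := by
  rw [Below, SimpleGraph.dist_self, zero_add]

theorem Below.trans (hT : T.IsTree) {r u v w : V} (h : Below T r u v) (h' : Below T r v w) :
    Below T r u w := by
  have h1 := hT.connected.dist_triangle (u := u) (v := v) (w := w)
  have h2 := hT.connected.dist_triangle (u := r) (v := u) (w := w)
  simp only [Below] at *
  omega

theorem Below.eq_of_dist_le (hT : T.IsTree) {r u v : V} (h : Below T r u v)
    (hd : T.dist r v ≤ T.dist r u) : u = v := by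
  rw [← dist_eq_zero hT]
  rw [Below] at h
  omega

theorem Below.antisymm (hT : T.IsTree) {r u v : V} (h : Below T r u v) (h' : Below T r v u) :
    u = v := by
  refine h.eq_of_dist_le hT ?_
  rw [Below] at h'
  omega

theorem Below.dist_le {r u v : V} (h : Below T r u v) : T.dist r u ≤ T.dist r v := by
  rw [Below] at h
  omega

/-- The vertices between `r` and `v` form a chain. -/
theorem Below.of_dist_le (hT : T.IsTree) {r u u' v : V} (h : Below T r u v) (h' : Below T r u' v)
    (hd : T.dist r u ≤ T.dist r u') : Below T r u u' := by
  induction hn : T.dist u' v generalizing v with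
  | zero => rwa [(dist_eq_zero hT).1 hn]
  | succ n ih =>
    have hne : ∀ w, T.dist w v ≠ 0 → v ≠ w := by
      rintro w hw rfl
      exact hw SimpleGraph.dist_self
    have hu' := hne u' (by omega)
    have hu := hne u (by simp only [Below] at *; omega)
    obtain ⟨a, ha, had⟩ := exists_closer hT hu
    obtain ⟨a', ha', had'⟩ := exists_closer hT hu'
    have key : ∀ w a, T.Adj v a → Below T r w v → T.dist w v = T.dist w a + 1 →
        T.dist r v = T.dist r a + 1 := by
      intro w a hva hw hd
      have h1 := hT.connected.dist_triangle (u := r) (v := w) (w := a)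
      have := dist_adj_cases hT r hva
      simp only [Below] at *
      omega
    have e1 := key _ _ ha h had
    have e2 := key _ _ ha' h' had'
    have := closer_unique hT ha ha' e1 e2
    subst this
    refine ih (v := a) ?_ ?_ (by omega)
    · simp only [Below] at *; omega
    · simp only [Below] at *; omega

theorem Below.total (hT : T.IsTree) {r u u' v : V} (h : Below T r u v) (h' : Below T r u' v) :
    Below T r u u' ∨ Below T r u' u := by
  rcases le_total (T.dist r u) (T.dist r u') with hd | hd
  · exact Or.inl (h.of_dist_le hT h' hd)
  · exact Or.inr (h'.of_dist_le hT h hd)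

/-- The common predecessors of `a` and `b` form a chain of bounded height, so the one farthest from
`r` dominates the others. -/
theorem exists_meet (hT : T.IsTree) (r a b : V) :
    ∃ m, Below T r m a ∧ Below T r m b ∧ ∀ u, Below T r u a → Below T r u b → Below T r u m := by
  classical
  let P : ℕ → Prop := fun n => ∃ m, Below T r m a ∧ Below T r m b ∧ T.dist r m = n
  have h0 : P 0 := ⟨r, below_root r a, below_root r b, SimpleGraph.dist_self⟩
  obtain ⟨m, h1, h2, h3⟩ : P (Nat.findGreatest P (T.dist r a)) := Nat.findGreatest_spec (Nat.zero_le _) h0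
  refine ⟨m, h1, h2, fun u hu hu' => hu.of_dist_le hT h1 ?_⟩
  rw [h3]
  exact Nat.le_findGreatest hu.dist_le ⟨u, hu, hu', rfl⟩

theorem below_of_mem_half (hT : T.IsTree) {r u v w : V} (h : T.Adj u v) (hr : r ∈ half T v u)
    (hw : w ∈ half T u v) : Below T r v w := by
  have := dist_add_dist hT h hr hw
  rw [mem_half] at hr
  rw [Below]
  omega

/-! ### Rays of a tree -/

namespace Ray

/-- The part of the origin in the tree cut at the edge `x_n x_{n+1}`. -/
def back (C : Ray T) (n : ℕ) : Set V := half T (C.vertex (n + 1)) (C.vertex n)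

/-- The part of the end in the tree cut at the edge `x_n x_{n+1}`. -/
def front (C : Ray T) (n : ℕ) : Set V := half T (C.vertex n) (C.vertex (n + 1))

theorem back_or_front (hT : T.IsTree) (C : Ray T) (n : ℕ) (w : V) : w ∈ C.back n ∨ w ∈ C.front n :=
  half_or hT (C.adj n).symm w

/-- Once the distance from `w` grows along the ray it keeps growing: at a turning point the ray
would have two neighbours nearer to `w`. -/
theorem dist_add_of_back (hT : T.IsTree) (C : Ray T) {w : V} {i : ℕ} (h : w ∈ C.back i) (n : ℕ) :
    T.dist w (C.vertex (i + n)) = T.dist w (C.vertex i) + n := by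
  have step : ∀ n, T.dist w (C.vertex (i + n + 1)) = T.dist w (C.vertex (i + n)) + 1 := by
    intro n
    induction n with
    | zero => exact h
    | succ n ih =>
      rcases dist_adj_cases hT w (C.adj (i + n + 1)) with h1 | h1
      · have := C.injective (closer_unique hT (C.adj (i + n + 1)) (C.adj (i + n)).symm h1 ih)
        omega
      · exact h1
  induction n with
  | zero => rfl
  | succ n ih => rw [← add_assoc, step, ih, add_assoc]

theorem dist_of_back (hT : T.IsTree) (C : Ray T) {w : V} {i j : ℕ} (h : w ∈ C.back i)
    (hij : i ≤ j) : T.dist w (C.vertex j) = T.dist w (C.vertex i) + (j - i) := by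
  obtain ⟨n, rfl⟩ := Nat.exists_eq_add_of_le hij
  rw [C.dist_add_of_back hT h, Nat.add_sub_cancel_left]

theorem back_mono (hT : T.IsTree) (C : Ray T) {i j : ℕ} (hij : i ≤ j) : C.back i ⊆ C.back j := by
  intro w hw
  have h1 := C.dist_of_back hT hw hij
  have h2 := C.dist_of_back hT hw (hij.trans (Nat.le_add_right j 1))
  change T.dist w (C.vertex (j + 1)) = _
  omega

theorem vertex_mem_back (C : Ray T) (i : ℕ) : C.vertex i ∈ C.back i :=
  left_mem_half (C.adj i)

theorem vertex_mem_front (C : Ray T) (i : ℕ) : C.vertex (i + 1) ∈ C.front i :=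
  right_mem_half (C.adj i)

theorem dist_vertex (hT : T.IsTree) (C : Ray T) {i j : ℕ} (hij : i ≤ j) :
    T.dist (C.vertex i) (C.vertex j) = j - i := by
  rw [C.dist_of_back hT (C.vertex_mem_back i) hij, SimpleGraph.dist_self, zero_add]

theorem front_anti (hT : T.IsTree) (C : Ray T) {i j : ℕ} (hij : i ≤ j) :
    C.front j ⊆ C.front i := fun w hw =>
  (C.back_or_front hT i w).resolve_left fun h => not_mem_half hw (C.back_mono hT hij h)

theorem vertex_mem_front_of_lt (hT : T.IsTree) (C : Ray T) {i j : ℕ} (hij : i < j) :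
    C.vertex j ∈ C.front i := by
  obtain ⟨k, rfl⟩ := Nat.exists_eq_add_of_le' (Nat.one_le_of_lt hij)
  exact C.front_anti hT (Nat.lt_succ_iff.1 hij) (C.vertex_mem_front k)

theorem vertex_mem_back_of_le (hT : T.IsTree) (C : Ray T) {i j : ℕ} (hij : j ≤ i) :
    C.vertex j ∈ C.back i := C.back_mono hT hij (C.vertex_mem_back j)

theorem exists_mem_back (hT : T.IsTree) (C : Ray T) (w : V) : ∃ n, w ∈ C.back n := by
  by_contra! h
  have h1 : ∀ n, T.dist w (C.vertex n) + n = T.dist w (C.vertex 0) := by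
    intro n
    induction n with
    | zero => rfl
    | succ n ih =>
      have := (C.back_or_front hT n w).resolve_left (h n)
      rw [front, mem_half] at this
      omega
  have := h1 (T.dist w (C.vertex 0) + 1)
  omega

theorem dist_back_front (hT : T.IsTree) (C : Ray T) {u v : V} {n m : ℕ} (hu : u ∈ C.back n)
    (hv : v ∈ C.front m) (h : n ≤ m) :
    T.dist u v = T.dist u (C.vertex n) + (m + 1 - n) + T.dist (C.vertex (m + 1)) v := by
  have h1 := dist_add_dist hT (C.adj m) (C.back_mono hT h hu) hv
  have h2 := C.dist_of_back hT hu h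
  omega

/-- The ray obtained by deleting the first `n` vertices. -/
def tail (C : Ray T) (n : ℕ) : Ray T where
  vertex i := C.vertex (n + i)
  injective _ _ h := Nat.add_left_cancel (C.injective h)
  adj i := C.adj (n + i)

/-- Consecutive vertices of `D` have indices in `D'` that differ by one. Injectivity forbids turning
and ℕ forbids descending forever, so the indices increase by one at each step. -/
theorem eq_shift_of_verts_subset (hT : T.IsTree) {D D' : Ray T} (h : D.verts ⊆ D'.verts) :
    ∃ b, ∀ n, D.vertex n = D'.vertex (b + n) := by
  have : ∀ n, ∃ m, D'.vertex m = D.vertex n := fun n => h ⟨n, rfl⟩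
  choose σ hσ using this
  have hinj : Function.Injective σ := by
    intro i j hij
    apply D.injective
    rw [← hσ, ← hσ, hij]
  have hstep : ∀ n, σ (n + 1) = σ n + 1 ∨ σ n = σ (n + 1) + 1 := by
    intro n
    have h1 := dist_adj (D.adj n)
    rw [← hσ, ← hσ] at h1
    rcases le_total (σ n) (σ (n + 1)) with h2 | h2
    · rw [D'.dist_vertex hT h2] at h1; omega
    · rw [SimpleGraph.dist_comm, D'.dist_vertex hT h2] at h1; omega
  have hup : ∀ n, σ (n + 1) = σ n + 1 := by
    intro n
    rcases hstep n with h1 | h1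
    · exact h1
    exfalso
    have hdown : ∀ k, σ (n + k) = σ (n + k + 1) + 1 := by
      intro k
      induction k with
      | zero => exact h1
      | succ k ih =>
        rcases hstep (n + (k + 1)) with h2 | h2
        · have h3 : σ (n + (k + 1) + 1) = σ (n + k) := by rw [h2, ih, add_assoc n k 1]
          have := hinj h3
          omega
        · exact h2
    have : ∀ k, σ (n + k) + k = σ n := by
      intro k
      induction k with
      | zero => rfl
      | succ k ih => have := hdown k; rw [← add_assoc n k 1]; omega
    have := this (σ n + 1)
    omega
  refine ⟨σ 0, fun n => ?_⟩
  rw [← hσ]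
  congr 1
  induction n with
  | zero => rfl
  | succ n ih => rw [hup, ih, add_assoc]

theorem equivalent_of_shift {C C' : Ray T} {a b : ℕ}
    (h : ∀ n, C.vertex (a + n) = C'.vertex (b + n)) : C.Equivalent C' := by
  refine ⟨C.vertex '' Set.Iio a ∪ C'.vertex '' Set.Iio b,
    ((Set.finite_Iio a).image _).union ((Set.finite_Iio b).image _), ?_⟩
  ext v
  constructor
  · rintro ⟨⟨n, rfl⟩, hv⟩
    refine ⟨?_, hv⟩
    rcases lt_or_ge n a with hn | hn
    · exact absurd (Or.inl ⟨n, hn, rfl⟩) hv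
    · obtain ⟨k, rfl⟩ := Nat.exists_eq_add_of_le hn
      exact ⟨b + k, (h k).symm⟩
  · rintro ⟨⟨n, rfl⟩, hv⟩
    refine ⟨?_, hv⟩
    rcases lt_or_ge n b with hn | hn
    · exact absurd (Or.inr ⟨n, hn, rfl⟩) hv
    · obtain ⟨k, rfl⟩ := Nat.exists_eq_add_of_le hn
      exact ⟨a + k, h k⟩

/-- The working form of equivalence: start one ray beyond the last index that lands in the finite
exceptional set, and what remains is a tail of the other ray. -/
theorem toEnd_eq_iff (hT : T.IsTree) {C C' : Ray T} :
    C.toEnd = C'.toEnd ↔ ∃ a b, ∀ n, C.vertex (a + n) = C'.vertex (b + n) := by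
  constructor
  · intro h
    obtain ⟨F, hF, h⟩ : C.Equivalent C' := Quotient.exact h
    have hfin : (C.vertex ⁻¹' F).Finite := hF.preimage C.injective.injOn
    obtain ⟨a, ha⟩ := hfin.bddAbove
    have hsub : (C.tail (a + 1)).verts ⊆ C'.verts := by
      rintro _ ⟨n, rfl⟩
      have h1 : C.vertex (a + 1 + n) ∈ C.verts \ F := by
        refine ⟨⟨_, rfl⟩, fun h2 => ?_⟩
        have := ha (show a + 1 + n ∈ C.vertex ⁻¹' F from h2)
        omega
      rw [h] at h1
      exact h1.1
    obtain ⟨b, hb⟩ := eq_shift_of_verts_subset hT hsub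
    exact ⟨a + 1, b, hb⟩
  · rintro ⟨a, b, h⟩
    exact Quotient.sound (s := Ray.setoid T) (equivalent_of_shift h)

theorem toEnd_tail (C : Ray T) (n : ℕ) : (C.tail n).toEnd = C.toEnd :=
  Quotient.sound (s := Ray.setoid T) (equivalent_of_shift (a := 0) (b := n)
    fun i => by simp [tail])

/-- The ray obtained by adding an origin. -/
def cons (hT : T.IsTree) (C : Ray T) (r : V) (h : T.Adj r (C.vertex 0)) (h' : r ≠ C.vertex 1) :
    Ray T where
  vertex n := n.casesOn r C.vertex
  adj n := by
    cases n with
    | zero => exact h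
    | succ n => exact C.adj n
  injective := by
    have key : ∀ n, r ≠ C.vertex n := by
      intro n hn
      have h1 := dist_adj h
      rw [SimpleGraph.dist_comm, hn, C.dist_vertex hT (Nat.zero_le n)] at h1
      obtain rfl : n = 1 := by omega
      exact h' hn
    intro i j hij
    cases i with
    | zero =>
      cases j with
      | zero => rfl
      | succ j => exact absurd hij (key j)
    | succ i =>
      cases j with
      | zero => exact absurd hij.symm (key i)
      | succ j => exact congrArg _ (C.injective hij)

theorem exists_from (hT : T.IsTree) (C : Ray T) (r : V) :
    ∃ D : Ray T, D.toEnd = C.toEnd ∧ D.vertex 0 = r := by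
  obtain ⟨p⟩ := hT.connected r (C.vertex 0)
  generalize hz : C.vertex 0 = z at p
  induction p with
  | nil => exact ⟨C, rfl, hz⟩
  | @cons u v w hadj p ih =>
    obtain ⟨D, hD, hD0⟩ := ih hz
    by_cases h : u = D.vertex 1
    · exact ⟨D.tail 1, (D.toEnd_tail 1).trans hD, h.symm⟩
    · refine ⟨D.cons hT u (hD0 ▸ hadj) h, Eq.trans ?_ hD, rfl⟩
      refine Quotient.sound (s := Ray.setoid T) (equivalent_of_shift (a := 1) (b := 0) fun i => ?_)
      rw [add_comm, zero_add]
      rfl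

/-- The image of a ray under an embedding. -/
def map (f : T ↪g T) (C : Ray T) : Ray T where
  vertex n := f (C.vertex n)
  injective := f.injective.comp C.injective
  adj n := f.map_adj_iff.2 (C.adj n)

theorem below_vertex (hT : T.IsTree) (C : Ray T) {i j : ℕ} (h : i ≤ j) :
    Below T (C.vertex 0) (C.vertex i) (C.vertex j) := by
  rw [Below, C.dist_vertex hT (Nat.zero_le _), C.dist_vertex hT h, C.dist_vertex hT (Nat.zero_le _)]
  omega

theorem eq_vertex_of_below (hT : T.IsTree) (C : Ray T) {s : V} {n : ℕ}
    (h : Below T (C.vertex 0) s (C.vertex n)) : ∃ i ≤ n, C.vertex i = s := by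
  have h1 := h.dist_le
  rw [C.dist_vertex hT (Nat.zero_le n)] at h1
  refine ⟨T.dist (C.vertex 0) s, by omega, ?_⟩
  have h2 := C.below_vertex hT (i := T.dist (C.vertex 0) s) (j := n) (by omega)
  have h3 : T.dist (C.vertex 0) (C.vertex (T.dist (C.vertex 0) s)) = T.dist (C.vertex 0) s := by
    rw [C.dist_vertex hT (Nat.zero_le _)]; rfl
  exact (h2.of_dist_le hT h h3.le).eq_of_dist_le hT h3.ge

end Ray

theorem TreeEnd.exists_ray (hT : T.IsTree) (e : TreeEnd T) (r : V) :
    ∃ C : Ray T, C.toEnd = e ∧ C.vertex 0 = r := by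
  induction e using Quotient.ind with
  | _ C => exact C.exists_from hT r

theorem mem_endsThrough (hT : T.IsTree) {r s : V} {C : Ray T} :
    C.toEnd ∈ endsThrough T r s ↔ ∃ N, ∀ n, N ≤ n → Below T r s (C.vertex n) := by
  constructor
  · rintro ⟨D, hD, rfl, i, rfl⟩
    obtain ⟨a, b, hab⟩ := (Ray.toEnd_eq_iff hT).1 hD
    refine ⟨b + i, fun n hn => ?_⟩
    have := hab (n - b)
    rw [show b + (n - b) = n by omega] at this
    rw [← this]
    exact D.below_vertex hT (by omega)
  · rintro ⟨N, hN⟩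
    obtain ⟨D, hD, rfl⟩ := C.exists_from hT r
    refine ⟨D, hD, rfl, ?_⟩
    obtain ⟨a, b, hab⟩ := (Ray.toEnd_eq_iff hT).1 hD
    have := hN (b + N) (by omega)
    rw [← hab] at this
    obtain ⟨i, -, hi⟩ := D.eq_vertex_of_below hT this
    exact ⟨i, hi⟩

/-! ### Subdivisions of the binary tree inside a tree -/

theorem list_bool_trichotomy (a b : List Bool) :
    a <+: b ∨ b <+: a ∨ ∃ p i u v, a = p ++ i :: u ∧ b = p ++ (!i) :: v := by
  induction a generalizing b with
  | nil => exact Or.inl List.nil_prefix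
  | cons i a ih =>
    cases b with
    | nil => exact Or.inr (Or.inl List.nil_prefix)
    | cons j b =>
      by_cases hij : i = j
      · subst hij
        rcases ih b with h | h | ⟨p, k, u, v, rfl, rfl⟩
        · exact Or.inl (List.cons_prefix_cons.2 ⟨rfl, h⟩)
        · exact Or.inr (Or.inl (List.cons_prefix_cons.2 ⟨rfl, h⟩))
        · exact Or.inr (Or.inr ⟨i :: p, k, u, v, rfl, rfl⟩)
      · refine Or.inr (Or.inr ⟨[], i, a, b, rfl, ?_⟩)
        have : j = !i := by cases i <;> cases j <;> simp_all
        rw [this]; rfl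

theorem binaryTree_adj {a b : List Bool} :
    binaryTree.Adj a b ↔ (∃ i, b = a ++ [i]) ∨ ∃ i, a = b ++ [i] := by
  rw [binaryTree, SimpleGraph.fromRel_adj]
  refine ⟨fun h => h.2, fun h => ⟨?_, h⟩⟩
  rintro rfl
  rcases h with ⟨i, h⟩ | ⟨i, h⟩ <;> simp at h

section Words

variable {r : V} {φ : List Bool → V}

theorem below_of_prefix (hT : T.IsTree) (mono : ∀ w i, Below T r (φ w) (φ (w ++ [i])))
    {w w' : List Bool} (h : w <+: w') : Below T r (φ w) (φ w') := by
  obtain ⟨u, rfl⟩ := h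
  induction u using List.reverseRecOn with
  | nil => rw [List.append_nil]; exact below_refl _ _
  | append_singleton u i ih => rw [← List.append_assoc]; exact ih.trans hT (mono _ _)

/-- If `c` and `d` diverged after `p`, the hypothesis `meet` would push `φ c` below `φ p`, against
strict growth along words. -/
theorem prefix_of_below (hT : T.IsTree) (mono : ∀ w i, Below T r (φ w) (φ (w ++ [i])))
    (strict : ∀ w i, φ w ≠ φ (w ++ [i]))
    (meet : ∀ p i u v x, Below T r x (φ (p ++ i :: u)) → Below T r x (φ (p ++ (!i) :: v)) →
      Below T r x (φ p)) {c d : List Bool} (h : Below T r (φ c) (φ d)) : c <+: d := by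
  have key : ∀ p i u, ¬ Below T r (φ (p ++ i :: u)) (φ p) := by
    intro p i u hb
    have h1 : Below T r (φ (p ++ [i])) (φ (p ++ i :: u)) :=
      below_of_prefix hT mono ⟨u, by simp⟩
    exact strict p i ((mono p i).antisymm hT (h1.trans hT hb))
  rcases list_bool_trichotomy c d with hcd | ⟨u, rfl⟩ | ⟨p, i, u, v, rfl, rfl⟩
  · exact hcd
  · cases u with
    | nil => rw [List.append_nil]
    | cons i u => exact absurd h (key _ _ _)
  · exact absurd (meet p i u v _ (below_refl _ _) h) (key _ _ _)

theorem mem_edges_induce {X : Set V} {u v x y : V} (p : T.Walk u v) (hp : ∀ z ∈ p.support, z ∈ X)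
    (hx : x ∈ X) (hy : y ∈ X) (h : s(x, y) ∈ p.edges) :
    s((⟨x, hx⟩ : X), ⟨y, hy⟩) ∈ (p.induce X hp).edges := by
  induction p with
  | nil => simp at h
  | cons hadj p ih =>
    rw [SimpleGraph.Walk.induce_cons, SimpleGraph.Walk.edges_cons, List.mem_cons]
    rw [SimpleGraph.Walk.edges_cons, List.mem_cons] at h
    rcases h with h | h
    · left
      rw [Sym2.eq_iff] at h ⊢
      simpa [Subtype.ext_iff] using h
    · exact Or.inr (ih _ h)

theorem prefix_concat {c w : List Bool} {i : Bool} (h1 : w <+: c) (h2 : c <+: w ++ [i]) :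
    c = w ∨ c = w ++ [i] := by
  rcases List.prefix_concat_iff.1 h2 with h | h
  · exact Or.inr h
  · exact Or.inl (h.eq_of_length_le h1.length_le)

/-- A system of vertices ordered like the vertices of the binary tree spans a subdivision of the
binary tree. -/
theorem not_isScattered_of_words (hT : T.IsTree)
    (mono : ∀ w i, Below T r (φ w) (φ (w ++ [i])))
    (strict : ∀ w i, φ w ≠ φ (w ++ [i]))
    (meet : ∀ p i u v x, Below T r x (φ (p ++ i :: u)) → Below T r x (φ (p ++ (!i) :: v)) →
      Below T r x (φ p)) : ¬ IsScattered T := by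
  classical
  intro hs
  have pre : ∀ {c d}, Below T r (φ c) (φ d) → c <+: d := prefix_of_below hT mono strict meet
  have bel : ∀ {c d}, c <+: d → Below T r (φ c) (φ d) := below_of_prefix hT mono
  -- The subdivision is the union of the geodesics joining the `φ w` to their successors.
  let X : Set V := {x | Below T r (φ []) x ∧ ∃ w, Below T r x (φ w)}
  have hφX : ∀ w, φ w ∈ X := fun w => ⟨bel List.nil_prefix, w, below_refl _ _⟩
  have between : ∀ {a b x}, Below T r a b →
      (T.dist a x + T.dist x b = T.dist a b ↔ Below T r a x ∧ Below T r x b) := by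
    intro a b x hab
    have h1 := hT.connected.dist_triangle (u := r) (v := a) (w := x)
    have h2 := hT.connected.dist_triangle (u := r) (v := x) (w := b)
    simp only [Below] at *
    constructor
    · intro h; constructor <;> omega
    · rintro ⟨h, h'⟩; omega
  choose Q hQ using fun a b : V => (hT.existsUnique_path a b).exists
  have hQsymm : ∀ a b, Q b a = (Q a b).reverse := fun a b =>
    (hT.existsUnique_path b a).unique (hQ _ _) (hQ _ _).reverse
  have supp : ∀ {w i x}, x ∈ (Q (φ w) (φ (w ++ [i]))).support ↔
      Below T r (φ w) x ∧ Below T r x (φ (w ++ [i])) := fun {w i x} => by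
    rw [mem_support_iff hT (hQ _ _), between (mono w i)]
  have supp' : ∀ {w i x}, x ∈ (Q (φ (w ++ [i])) (φ w)).support ↔
      Below T r (φ w) x ∧ Below T r x (φ (w ++ [i])) := fun {w i x} => by
    rw [hQsymm, SimpleGraph.Walk.support_reverse, List.mem_reverse, supp]
  have edge : ∀ {a b}, binaryTree.Adj a b → ∃ w i, s(a, b) = s(w, w ++ [i]) ∧
      ∀ x, x ∈ (Q (φ a) (φ b)).support ↔ Below T r (φ w) x ∧ Below T r x (φ (w ++ [i])) := by
    intro a b h
    rcases binaryTree_adj.1 h with ⟨i, rfl⟩ | ⟨i, rfl⟩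
    · exact ⟨a, i, rfl, fun x => supp⟩
    · exact ⟨b, i, Sym2.eq_swap, fun x => supp'⟩
  have hQX : ∀ {a b}, binaryTree.Adj a b → ∀ x ∈ (Q (φ a) (φ b)).support, x ∈ X := by
    intro a b h x hx
    obtain ⟨w, i, -, hw⟩ := edge h
    obtain ⟨h1, h2⟩ := (hw x).1 hx
    exact ⟨(bel List.nil_prefix).trans hT h1, _, h2⟩
  have hadj : ∀ w i, binaryTree.Adj w (w ++ [i]) := fun w i => binaryTree_adj.2 (Or.inl ⟨i, rfl⟩)
  -- The segments are taken half-open, without their lower endpoint, so that the predecessor of a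
  -- covered vertex lies in the same closed segment; this is what the edge condition needs.
  have cover : ∀ x ∈ X, x ≠ φ [] → ∃ w i, Below T r (φ w) x ∧ x ≠ φ w ∧
      Below T r x (φ (w ++ [i])) := by
    rintro x ⟨h0, w, hw⟩ hne
    induction w using List.reverseRecOn with
    | nil => exact absurd (hw.antisymm hT h0) hne
    | append_singleton w i ih =>
      rcases hw.total hT (mono w i) with h | h
      · exact ih h
      · by_cases hx : x = φ w
        · exact ih (hx ▸ below_refl _ _)
        · exact ⟨w, i, h, hx, hw⟩
  refine (hs X (T.induce X) ⟨⟨fun w => ⟨φ w, hφX w⟩, ?_⟩,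
    fun a b h => (Q (φ a) (φ b)).induce X (hQX h), ?_, ?_, ?_, ?_, ?_, ?_⟩).false
    (SimpleGraph.Embedding.induce X)
  · intro c d h
    have h : φ c = φ d := congrArg Subtype.val h
    have h1 : c <+: d := pre (h ▸ below_refl _ _)
    have h2 : d <+: c := pre (h ▸ below_refl _ _)
    exact h1.eq_of_length_le h2.length_le
  · intro a b h
    refine SimpleGraph.Walk.IsPath.of_map (f := (SimpleGraph.Embedding.induce X).toHom) ?_
    have := SimpleGraph.Walk.map_induce (Q (φ a) (φ b)) (hQX h)
    exact this ▸ hQ (φ a) (φ b)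
  · intro a b h
    apply SimpleGraph.Walk.map_injective_of_injective
      (f := (SimpleGraph.Embedding.induce X : T.induce X ↪g T).toHom)
      (SimpleGraph.Embedding.induce X : T.induce X ↪g T).injective
    rw [← SimpleGraph.Walk.reverse_map]
    refine (SimpleGraph.Walk.map_induce (Q (φ b) (φ a)) (hQX h.symm)).trans ?_
    refine Eq.trans (hQsymm _ _) ?_
    exact congrArg SimpleGraph.Walk.reverse
      (SimpleGraph.Walk.map_induce (Q (φ a) (φ b)) (hQX h)).symm
  · intro a b h c hc
    rw [SimpleGraph.Walk.support_induce] at hc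
    have hc : φ c ∈ (Q (φ a) (φ b)).support := by
      simp only [List.mem_attachWith] at hc
      exact hc
    obtain ⟨w, i, hw, hx⟩ := edge h
    obtain ⟨h1, h2⟩ := (hx _).1 hc
    have h3 : c ∈ s(a, b) := by
      rw [hw, Sym2.mem_iff]
      exact prefix_concat (pre h1) (pre h2)
    exact Sym2.mem_iff.1 h3
  · rintro a b h a' b' h' ⟨x, hxX⟩ hx hx'
    rw [SimpleGraph.Walk.support_induce] at hx hx'
    have hx : x ∈ (Q (φ a) (φ b)).support := by simpa using hx
    have hx' : x ∈ (Q (φ a') (φ b')).support := by simpa using hx'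
    obtain ⟨w, i, hw, hs⟩ := edge h
    obtain ⟨w', i', hw', hs'⟩ := edge h'
    obtain ⟨h1, h2⟩ := (hs x).1 hx
    obtain ⟨h1', h2'⟩ := (hs' x).1 hx'
    rw [hw, hw']
    have fin : ∀ w, φ w = x → (⟨x, hxX⟩ : X) ∈ Set.range fun w => (⟨φ w, hφX w⟩ : X) :=
      fun w hw => ⟨w, Subtype.ext hw⟩
    have fin' : ∀ {w w' : List Bool} {i i' : Bool}, Below T r x (φ (w ++ [i])) →
        Below T r (φ w') x → w ++ [i] <+: w' ++ [i'] →
        w ++ [i] = w' ++ [i'] ∨ φ (w ++ [i]) = x := by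
      intro w w' i i' h2 h1' hp
      rcases List.prefix_concat_iff.1 hp with hp | hp
      · exact Or.inl hp
      · exact Or.inr (((bel hp).trans hT h1').antisymm hT h2)
    have same : w ++ [i] = w' ++ [i'] → s(w, w ++ [i]) = s(w', w' ++ [i']) := by
      intro h
      obtain ⟨h1, h2⟩ := List.append_inj' h rfl
      rw [h, h1]
    -- A subdivided edge is determined by its upper word. If the upper words are comparable and
    -- distinct, a common vertex is the top of the lower segment; if they diverge after `p`, it lies
    -- below `φ p` and hence is `φ w`.
    rcases list_bool_trichotomy (w ++ [i]) (w' ++ [i']) with hp | hp | ⟨p, j, u, v, e1, e2⟩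
    · rcases fin' h2 h1' hp with h | h
      · exact Or.inl (same h)
      · exact Or.inr (fin _ h)
    · rcases fin' h2' h1 hp with h | h
      · exact Or.inl (same h.symm)
      · exact Or.inr (fin _ h)
    · right
      have hxp : Below T r x (φ p) := meet p j u v x (e1 ▸ h2) (e2 ▸ h2')
      have hpw : p <+: w := by
        have h3 : p <+: w ++ [i] := ⟨j :: u, e1.symm⟩
        rcases List.prefix_concat_iff.1 h3 with h4 | h4
        · rw [h4] at e1
          simp at e1
        · exact h4
      exact fin w (h1.antisymm hT (hxp.trans hT (bel hpw)))
  · rintro ⟨x, hxX⟩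
    by_cases hx : x = φ []
    · exact Or.inl ⟨[], Subtype.ext hx.symm⟩
    · obtain ⟨w, i, h1, -, h2⟩ := cover x hxX hx
      refine Or.inr ⟨w, w ++ [i], hadj w i, ?_⟩
      rw [SimpleGraph.Walk.support_induce]
      simpa using supp.2 ⟨h1, h2⟩
  · have main : ∀ x (hx : x ∈ X) y (hy : y ∈ X), T.Adj x y → Below T r x y →
        ∃ a b h, s((⟨x, hx⟩ : X), ⟨y, hy⟩) ∈ ((Q (φ a) (φ b)).induce X (hQX h)).edges := by
      intro x hx y hy hxy hb
      have hxy1 := dist_adj hxy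
      have hne : y ≠ φ [] := by
        rintro rfl
        have := hb.antisymm hT hx.1
        exact hxy.ne this
      obtain ⟨w, i, h1, hn, h2⟩ := cover y hy hne
      have h3 : Below T r (φ w) x := by
        refine h1.of_dist_le hT hb ?_
        have h4 : T.dist (φ w) y ≠ 0 := fun h => hn ((dist_eq_zero hT).1 h).symm
        simp only [Below] at *
        omega
      refine ⟨w, w ++ [i], hadj w i, ?_⟩
      have h5 : s(x, y) ∈ (Q (φ w) (φ (w ++ [i]))).edges := by
        refine mem_edges_of_dist hT (hQ _ _) hxy ?_
        have := mono w i
        simp only [Below] at *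
        omega
      exact mem_edges_induce _ _ hx hy h5
    rintro ⟨x, hx⟩ ⟨y, hy⟩ hxy
    have hxy : T.Adj x y := hxy
    have hd := dist_adj hxy
    have hd' := dist_adj hxy.symm
    rcases dist_adj_cases hT r hxy with h | h
    · obtain ⟨a, b, hab, h1⟩ := main y hy x hx hxy.symm (by rw [Below]; omega)
      exact ⟨a, b, hab, Sym2.eq_swap ▸ h1⟩
    · exact main x hx y hy hxy (by rw [Below]; omega)

end Words

/-- If every vertex of a nonempty set `G` has two incomparable vertices of `G` above it, then the
tree contains a subdivision of the binary tree. -/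
theorem not_isScattered_of_branching (hT : T.IsTree) (r : V) {G : Set V} (hG : G.Nonempty)
    (h : ∀ s ∈ G, ∃ a ∈ G, ∃ b ∈ G, Below T r s a ∧ Below T r s b ∧ ¬ Below T r a b ∧
      ¬ Below T r b a) : ¬ IsScattered T := by
  have h' : ∀ s : G, ∃ c : Bool → G, (∀ i, Below T r s (c i)) ∧
      ∀ i, ¬ Below T r (c i : V) (c !i) := by
    rintro ⟨s, hs⟩
    obtain ⟨a, ha, b, hb, h1, h2, h3, h4⟩ := h s hs
    exact ⟨fun i => cond i ⟨a, ha⟩ ⟨b, hb⟩, by rintro (_ | _) <;> assumption,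
      by rintro (_ | _) <;> assumption⟩
  choose child above inc using h'
  have hm : ∀ s : G, ∃ m, (∀ i, Below T r m (child s i)) ∧
      ∀ x i, Below T r x (child s i) → Below T r x (child s !i) → Below T r x m := by
    intro s
    obtain ⟨m, h1, h2, h3⟩ := exists_meet hT r (child s true) (child s false : V)
    refine ⟨m, by rintro (_ | _) <;> assumption, ?_⟩
    rintro x (_ | _) h4 h5
    · exact h3 x h5 h4
    · exact h3 x h4 h5
  choose m hm1 hm2 using hm
  obtain ⟨s0, hs0⟩ := hG
  -- The recursion runs on the reversed word, so that appending a letter on the right passes to a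
  -- child.
  let σ : List Bool → G := fun w => w.reverse.rec ⟨s0, hs0⟩ fun i _ s => child s i
  have hσ : ∀ w i, σ (w ++ [i]) = child (σ w) i := by
    intro w i
    simp only [σ, List.reverse_append, List.reverse_cons, List.reverse_nil, List.nil_append,
      List.singleton_append]
  have f1 : ∀ w : List Bool, Below T r (σ w).1 (m (σ w)) := fun w =>
    hm2 (σ w) (σ w).1 true (above (σ w) true) (above (σ w) (!true))
  have mono : ∀ w i, Below T r (m (σ w)) (m (σ (w ++ [i]))) := fun w i =>
    (hσ w i ▸ hm1 (σ w) i : Below T r (m (σ w)) (σ (w ++ [i])).1).trans hT (f1 _)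
  have f4 : ∀ (p : List Bool) (i : Bool) (u : List Bool), Below T r (child (σ p) i).1 (m (σ (p ++ i :: u))) := by
    intro p i u
    have h1 := f1 (p ++ [i])
    rw [hσ] at h1
    refine h1.trans hT ?_
    rw [← hσ]
    exact below_of_prefix (φ := fun w => m (σ w)) hT mono ⟨u, by simp⟩
  -- The branch vertices are the meets of the two children: the chosen vertices of `G` themselves
  -- need not be the places where the paths separate.
  refine not_isScattered_of_words (r := r) (φ := fun w => m (σ w)) hT mono ?_ ?_
  · intro w i hw
    have h1 := f1 (w ++ [i])
    have hw : m (σ w) = m (σ (w ++ [i])) := hw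
    rw [← hw, hσ] at h1
    exact inc _ i (h1.trans hT (hm1 _ _))
  · intro p i u v x hx hx'
    have h1 := f4 p i u
    have h2 := f4 p (!i) v
    have key : ∀ j (y : V), Below T r (child (σ p) j : V) x → Below T r x y →
        ¬ Below T r (child (σ p) (!j) : V) y := by
      intro j y h3 h4 h5
      rcases (h3.trans hT h4).total hT h5 with h6 | h6
      · exact inc _ _ h6
      · refine inc (σ p) (!j) ?_
        rwa [Bool.not_not]
    have side : ∀ j (y z : V), Below T r x y → Below T r x z → Below T r (child (σ p) j : V) y →
        Below T r (child (σ p) (!j) : V) z → Below T r x (child (σ p) j : V) := by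
      intro j y z h3 h3' h4 h5
      rcases h3.total hT h4 with h6 | h6
      · exact h6
      · exact absurd h5 (key j z h6 h3')
    refine hm2 _ _ i (side i _ _ hx hx' h1 h2) (side (!i) _ _ hx' hx h2 ?_)
    rwa [Bool.not_not]

/-! ### The topology of the space of ends -/

open CantorBendixson

theorem mem_endsThrough_adj (hT : T.IsTree) {u v : V} (h : T.Adj u v) {C : Ray T} :
    C.toEnd ∈ endsThrough T u v ↔ ∃ N, ∀ n, N ≤ n → C.vertex n ∈ half T u v := by
  rw [mem_endsThrough hT]
  have : ∀ w, Below T u v w ↔ w ∈ half T u v := by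
    intro w
    rw [Below, mem_half, dist_adj h, SimpleGraph.dist_comm (u := w), SimpleGraph.dist_comm (u := w)]
    omega
  simp only [this]

theorem Ray.toEnd_mem_endsThrough (hT : T.IsTree) (C : Ray T) (n : ℕ) :
    C.toEnd ∈ endsThrough T (C.vertex n) (C.vertex (n + 1)) :=
  (mem_endsThrough_adj hT (C.adj n)).2 ⟨n + 1, fun _ hm => C.vertex_mem_front_of_lt hT hm⟩

theorem endsThrough_vertex_anti (hT : T.IsTree) (C : Ray T) {i j : ℕ} (h : i ≤ j) :
    endsThrough T (C.vertex j) (C.vertex (j + 1)) ⊆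
      endsThrough T (C.vertex i) (C.vertex (i + 1)) := by
  intro e he
  obtain ⟨D, rfl, -⟩ := e.exists_ray hT (C.vertex 0)
  rw [mem_endsThrough_adj hT (C.adj _)] at he ⊢
  obtain ⟨N, hN⟩ := he
  exact ⟨N, fun n hn => C.front_anti hT h (hN n hn)⟩

theorem endsThrough_or (hT : T.IsTree) {u v : V} (h : T.Adj u v) (e : TreeEnd T) :
    e ∈ endsThrough T u v ∨ e ∈ endsThrough T v u := by
  obtain ⟨D, rfl, rfl⟩ := e.exists_ray hT u
  by_cases hv : D.vertex 1 = v
  · left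
    exact ⟨D, rfl, rfl, 1, hv⟩
  · right
    refine (mem_endsThrough_adj hT h.symm).2 ⟨0, fun n _ => ?_⟩
    cases n with
    | zero => exact left_mem_half h
    | succ n =>
      refine half_subset hT (D.adj 0) h hv ?_
      exact D.vertex_mem_front_of_lt hT (Nat.succ_pos n)

theorem endsThrough_disjoint (hT : T.IsTree) {u v : V} (h : T.Adj u v) {e : TreeEnd T}
    (h1 : e ∈ endsThrough T u v) : e ∉ endsThrough T v u := by
  intro h2
  obtain ⟨D, rfl, rfl⟩ := e.exists_ray hT u
  obtain ⟨N, hN⟩ := (mem_endsThrough_adj hT h).1 h1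
  obtain ⟨N', hN'⟩ := (mem_endsThrough_adj hT h.symm).1 h2
  exact not_mem_half (hN _ (le_max_left N N')) (hN' _ (le_max_right N N'))

theorem eq_toEnd_of_forall_mem (hT : T.IsTree) {C : Ray T} {e : TreeEnd T}
    (h : ∀ n, e ∈ endsThrough T (C.vertex n) (C.vertex (n + 1))) : e = C.toEnd := by
  obtain ⟨D, rfl, h0⟩ := e.exists_ray hT (C.vertex 0)
  refine (Ray.toEnd_eq_iff hT).2 ⟨0, 0, fun n => ?_⟩
  rw [Nat.zero_add]
  obtain ⟨N, hN⟩ := (mem_endsThrough_adj hT (C.adj n)).1 (h n)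
  have h1 := below_of_mem_half hT (C.adj n) (C.vertex_mem_back_of_le hT (Nat.zero_le n)) (hN N le_rfl)
  have h2 := (C.below_vertex hT (Nat.le_add_right n 1)).trans hT h1
  rw [← h0] at h2
  obtain ⟨i, -, hi⟩ := D.eq_vertex_of_below hT h2
  have h3 := C.dist_vertex hT (Nat.zero_le n)
  rw [← h0, ← hi, D.dist_vertex hT (Nat.zero_le i)] at h3
  rw [← hi, show i = n by omega]

/-- Far enough along the ray, `r` is behind the cut edge and `s` is already passed. Hence the edges
of one ray give a countable neighbourhood basis of its end. -/
theorem endsThrough_vertex_subset (hT : T.IsTree) {C : Ray T} {r s : V}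
    (h : C.toEnd ∈ endsThrough T r s) :
    ∃ n, endsThrough T (C.vertex n) (C.vertex (n + 1)) ⊆ endsThrough T r s := by
  obtain ⟨N, hN⟩ := (mem_endsThrough hT).1 h
  obtain ⟨N', hN'⟩ := C.exists_mem_back hT r
  refine ⟨max N N', fun e he => ?_⟩
  obtain ⟨D, rfl, -⟩ := e.exists_ray hT r
  obtain ⟨M, hM⟩ := (mem_endsThrough_adj hT (C.adj _)).1 he
  refine (mem_endsThrough hT).2 ⟨M, fun n hn => ?_⟩
  exact (hN (max N N' + 1) (by omega)).trans hT
    (below_of_mem_half hT (C.adj _) (C.back_mono hT (le_max_right N N') hN') (hM n hn))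

theorem nhds_toEnd_hasBasis (hT : T.IsTree) (C : Ray T) :
    (nhds C.toEnd).HasBasis (fun _ : ℕ => True)
      fun n => endsThrough T (C.vertex n) (C.vertex (n + 1)) := by
  have h : nhds C.toEnd =
      ⨅ n : ℕ, Filter.principal (endsThrough T (C.vertex n) (C.vertex (n + 1))) := by
    apply le_antisymm
    · refine le_iInf fun n => Filter.le_principal_iff.2 (IsOpen.mem_nhds ?_ ?_)
      · exact TopologicalSpace.isOpen_generateFrom_of_mem ⟨_, _, rfl⟩
      · exact C.toEnd_mem_endsThrough hT n
    · rw [TopologicalSpace.nhds_generateFrom]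
      refine le_iInf₂ fun U hU => ?_
      obtain ⟨h1, r, s, rfl⟩ := hU
      obtain ⟨n, hn⟩ := endsThrough_vertex_subset hT h1
      exact (iInf_le _ n).trans (Filter.principal_mono.2 hn)
  rw [h]
  refine Filter.hasBasis_iInf_principal ?_
  exact directed_of_isDirected_le fun i j hij => endsThrough_vertex_anti hT C hij

theorem toEnd_mem_derivedSet (hT : T.IsTree) {C : Ray T} {A : Set (TreeEnd T)} :
    AccPt C.toEnd (Filter.principal A) ↔
      ∀ n, ∃ e ∈ A, e ≠ C.toEnd ∧ e ∈ endsThrough T (C.vertex n) (C.vertex (n + 1)) := by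
  rw [accPt_iff_nhds]
  constructor
  · intro h n
    obtain ⟨e, ⟨h1, h2⟩, h3⟩ := h _ ((nhds_toEnd_hasBasis hT C).mem_of_mem (i := n) trivial)
    exact ⟨e, h2, h3, h1⟩
  · intro h U hU
    obtain ⟨n, -, hn⟩ := (nhds_toEnd_hasBasis hT C).mem_iff.1 hU
    obtain ⟨e, h1, h2, h3⟩ := h n
    exact ⟨e, ⟨hn h3, h1⟩, h2⟩

/-- In a scattered tree the space of ends is scattered. -/
theorem exists_notMem_of_isScattered (hT : T.IsTree) (hs : IsScattered T) (e : TreeEnd T) :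
    ∃ β : Ordinal.{u}, e ∉ iteratedDerivedSet (Set.univ : Set (TreeEnd T)) β := by
  by_contra! h
  have hP : Perfect (perfectKernel (Set.univ : Set (TreeEnd T))) :=
    perfect_perfectKernel isClosed_univ
  have he : e ∈ perfectKernel (Set.univ : Set (TreeEnd T)) := Set.mem_iInter.2 h
  obtain ⟨r⟩ := hT.connected.nonempty
  -- An end in all derivatives makes the perfect kernel nonempty. Since the kernel has no isolated
  -- point, any vertex through which one of its ends passes is passed by a second one, and the two
  -- rays from `r` eventually separate.
  refine not_isScattered_of_branching hT r
    (G := {s | ∃ e ∈ perfectKernel (Set.univ : Set (TreeEnd T)), e ∈ endsThrough T r s})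
    ?_ ?_ hs
  · obtain ⟨C, rfl, h0⟩ := e.exists_ray hT r
    exact ⟨r, _, he, C, rfl, h0, 0, h0⟩
  · rintro s ⟨_, he, C, rfl, rfl, n, rfl⟩
    obtain ⟨e', he', hne, hthr⟩ := (toEnd_mem_derivedSet hT).1 (hP.acc _ he) n
    obtain ⟨D, rfl, h0⟩ := e'.exists_ray hT (C.vertex 0)
    have hD : ∃ i, D.vertex i = C.vertex n := by
      obtain ⟨N, hN⟩ := (mem_endsThrough_adj hT (C.adj n)).1 hthr
      have h1 := below_of_mem_half hT (C.adj n) (C.vertex_mem_back_of_le hT (Nat.zero_le n))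
        (hN N le_rfl)
      have h2 := (C.below_vertex hT (Nat.le_add_right n 1)).trans hT h1
      rw [← h0] at h2
      obtain ⟨i, -, hi⟩ := D.eq_vertex_of_below hT h2
      exact ⟨i, hi⟩
    obtain ⟨i, hi⟩ := hD
    have hin : i = n := by
      have h3 := C.dist_vertex hT (Nat.zero_le n)
      rw [← h0, ← hi, D.dist_vertex hT (Nat.zero_le i)] at h3
      omega
    subst hin
    obtain ⟨m, hm⟩ : ∃ m, D.vertex m ≠ C.vertex m := by
      by_contra! h1
      exact hne ((Ray.toEnd_eq_iff hT).2 ⟨0, 0, fun n => by rw [h1]⟩)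
    -- Rays from the same origin that differ at `m` differ from then on. The two vertices have equal
    -- depth, so being distinct makes them incomparable.
    have hne' : D.vertex (max m i) ≠ C.vertex (max m i) := by
      intro h1
      have h2 := D.below_vertex hT (le_max_left m i)
      rw [h1, h0] at h2
      refine hm (Below.antisymm hT (h2.of_dist_le hT (C.below_vertex hT (le_max_left m i)) ?_)
        ((C.below_vertex hT (le_max_left m i)).of_dist_le hT h2 ?_)) <;>
      rw [C.dist_vertex hT (Nat.zero_le m), ← h0, D.dist_vertex hT (Nat.zero_le m)]
    have hdC := C.dist_vertex hT (Nat.zero_le (max m i))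
    have hdD := D.dist_vertex hT (Nat.zero_le (max m i))
    rw [h0] at hdD
    refine ⟨C.vertex (max m i), ⟨_, he, C, rfl, rfl, _, rfl⟩, D.vertex (max m i),
      ⟨_, he', D, rfl, h0, _, rfl⟩, C.below_vertex hT (le_max_right m i), ?_, ?_, ?_⟩
    · rw [← h0, ← hi]
      exact D.below_vertex hT (le_max_right m i)
    · exact fun h1 => hne' (h1.eq_of_dist_le hT (by omega)).symm
    · exact fun h1 => hne' (h1.eq_of_dist_le hT (by omega))

theorem exists_hasOrder (hT : T.IsTree) (hs : IsScattered T) (e : TreeEnd T) :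
    ∃ α, e.HasOrder α := by
  obtain ⟨β, hβ⟩ := exists_notMem_of_isScattered hT hs e
  let S : Set Ordinal.{u} := {β | e ∉ iteratedDerivedSet (Set.univ : Set (TreeEnd T)) (β + 1)}
  have hS : S.Nonempty := ⟨β, fun h =>
    hβ (iteratedDerivedSet_antitone _ (Order.le_succ β) h)⟩
  exact ⟨sInf S, csInf_mem hS, fun b hb => csInf_le' hb⟩

/-- Minimality of `α` gives membership in every derivative `β + 1` with `β < α`; these determine the
`α`-th one, by intersection at a limit. -/
theorem TreeEnd.HasOrder.mem {e : TreeEnd T} {α : Ordinal.{u}} (h : e.HasOrder α) :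
    e ∈ iteratedDerivedSet (Set.univ : Set (TreeEnd T)) α := by
  have hlt : ∀ β < α, e ∈ iteratedDerivedSet (Set.univ : Set (TreeEnd T)) (β + 1) := by
    intro β hβ
    by_contra hn
    exact absurd (h.2 hn) (not_le.2 hβ)
  induction α using Ordinal.limitRecOn with
  | zero => simp
  | add_one a _ => exact hlt a (lt_add_one a)
  | limit a ha _ =>
    rw [iteratedDerivedSet_limit ha]
    refine Set.mem_iInter.2 fun b => ?_
    exact iteratedDerivedSet_antitone _ (Order.le_succ b.1) (hlt b.1 b.2)

/-- An end that lies in the derivative of the order of an end of maximal order has itself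
maximal order. -/
theorem hasMaximalOrder_of_mem (hT : T.IsTree) (hs : IsScattered T) {e' : TreeEnd T}
    {α : Ordinal.{u}} (hα : ∀ e' : TreeEnd T, ∀ β, e'.HasOrder β → β ≤ α)
    (h : e' ∈ iteratedDerivedSet (Set.univ : Set (TreeEnd T)) α) : e'.HasMaximalOrder := by
  obtain ⟨γ, hγ⟩ := exists_hasOrder hT hs e'
  have h1 : α ≤ γ := by
    by_contra! hlt
    exact hγ.1 (iteratedDerivedSet_antitone _ (Order.succ_le_of_lt hlt) h)
  have h2 := hα e' γ hγ
  obtain rfl := le_antisymm h2 h1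
  exact ⟨_, hγ, hα⟩

/-! ### The action of embeddings on ends -/

/-- The map on ends induced by an embedding. -/
def endMap (f : T ↪g T) : TreeEnd T → TreeEnd T :=
  Quotient.map' (Ray.map f) (by
    rintro C C' ⟨F, hF, h⟩
    refine ⟨f '' F, hF.image _, ?_⟩
    have : ∀ C : Ray T, (C.map f).verts = f '' C.verts := fun C => Set.range_comp f C.vertex
    rw [this, this, ← Set.image_sdiff f.injective, ← Set.image_sdiff f.injective, h])

theorem endMap_toEnd (f : T ↪g T) (C : Ray T) : endMap f C.toEnd = (C.map f).toEnd := rfl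

theorem endMap_injective (hT : T.IsTree) (f : T ↪g T) : Function.Injective (endMap f) := by
  intro e e'
  induction e using Quotient.ind with
  | _ C =>
    induction e' using Quotient.ind with
    | _ C' =>
      intro h
      obtain ⟨a, b, h⟩ := (Ray.toEnd_eq_iff hT (C := C.map f) (C' := C'.map f)).1 h
      exact (Ray.toEnd_eq_iff hT).2 ⟨a, b, fun n => f.injective (h n)⟩

theorem map_mem_half (hT : T.IsTree) (f : T ↪g T) {u v w : V} (h : w ∈ half T u v) :
    f w ∈ half T (f u) (f v) := by
  rw [mem_half] at *
  rw [dist_embedding hT, dist_embedding hT, h]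

theorem endMap_mem_endsThrough (hT : T.IsTree) (f : T ↪g T) {u v : V} (h : T.Adj u v)
    {e : TreeEnd T} (he : e ∈ endsThrough T u v) : endMap f e ∈ endsThrough T (f u) (f v) := by
  obtain ⟨D, rfl, -⟩ := e.exists_ray hT u
  rw [endMap_toEnd, mem_endsThrough_adj hT (f.map_adj_iff.2 h)]
  obtain ⟨N, hN⟩ := (mem_endsThrough_adj hT h).1 he
  exact ⟨N, fun n hn => map_mem_half hT f (hN n hn)⟩

theorem mem_iteratedDerivedSet_succ (hT : T.IsTree) {C : Ray T} {β : Ordinal.{u}} :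
    C.toEnd ∈ iteratedDerivedSet (Set.univ : Set (TreeEnd T)) (β + 1) ↔
      (∀ n, ∃ e ∈ iteratedDerivedSet (Set.univ : Set (TreeEnd T)) β, e ≠ C.toEnd ∧
        e ∈ endsThrough T (C.vertex n) (C.vertex (n + 1))) ∧
      C.toEnd ∈ iteratedDerivedSet (Set.univ : Set (TreeEnd T)) β := by
  rw [iteratedDerivedSet_succ, relDerivedSet_apply, Set.mem_inter_iff, mem_derivedSet,
    toEnd_mem_derivedSet hT]

/-- Edge neighbourhoods are carried into edge neighbourhoods, and injectivity on ends keeps the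
accumulating ends different from the limit. -/
theorem endMap_mem_iteratedDerivedSet (hT : T.IsTree) (f : T ↪g T) (β : Ordinal.{u}) :
    ∀ e ∈ iteratedDerivedSet (Set.univ : Set (TreeEnd T)) β,
      endMap f e ∈ iteratedDerivedSet (Set.univ : Set (TreeEnd T)) β := by
  induction β using Ordinal.limitRecOn with
  | zero => simp
  | add_one β ih =>
    intro e he
    obtain ⟨r⟩ := hT.connected.nonempty
    obtain ⟨C, rfl, -⟩ := e.exists_ray hT r
    rw [endMap_toEnd]
    rw [mem_iteratedDerivedSet_succ hT] at he ⊢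
    refine ⟨fun n => ?_, ih _ he.2⟩
    obtain ⟨e, h1, h2, h3⟩ := he.1 n
    exact ⟨endMap f e, ih _ h1, fun h => h2 (endMap_injective hT f h),
      endMap_mem_endsThrough hT f (C.adj n) h3⟩
  | limit a ha ih =>
    intro e he
    rw [iteratedDerivedSet_limit ha, Set.mem_iInter] at he ⊢
    exact fun b => ih b.1 b.2 e (he b)

/-! ### The opposite end of a backward shift -/

section Backward

variable {f : T ↪g T} {C : Ray T} {m : ℕ}

theorem iterate_adj (f : T ↪g T) {u v : V} (k : ℕ) (h : T.Adj u v) : T.Adj (f^[k] u) (f^[k] v) := by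
  induction k with
  | zero => exact h
  | succ k ih => rw [Function.iterate_succ_apply', Function.iterate_succ_apply']
                 exact f.map_adj_iff.2 ih

theorem iterate_shift (h : ∀ n, f (C.vertex (n + m)) = C.vertex n) (j i n : ℕ) :
    f^[i + j] (C.vertex (n + j * m)) = f^[i] (C.vertex n) := by
  induction j with
  | zero => simp
  | succ j ih =>
    rw [← add_assoc, Function.iterate_succ_apply, Nat.succ_mul, ← add_assoc, h, ih]

/-- If `f` shifts a ray towards its origin, the images of the ray extend it to a double ray; this
is the other half of the double ray. -/
def oppositeRay (f : T ↪g T) (C : Ray T) (m : ℕ) (hm : 0 < m)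
    (h : ∀ n, f (C.vertex (n + m)) = C.vertex n) : Ray T where
  -- In the double ray, `f^[k]` of the vertex of index `n` has index `n - k * m`. This choice
  -- therefore has index `-k`, and `k * m - k` is no truncation because `0 < m`.
  vertex k := f^[k] (C.vertex (k * m - k))
  injective := by
    have key : ∀ k l, k ≤ l → f^[k] (C.vertex (k * m - k)) = f^[l] (C.vertex (l * m - l)) →
        k = l := by
      intro k l hkl hkl'
      obtain ⟨j, rfl⟩ := Nat.exists_eq_add_of_le hkl
      rw [← iterate_shift h j k] at hkl'
      have h1 := C.injective ((f.injective.iterate _) hkl')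
      have h2 : k ≤ k * m := Nat.le_mul_of_pos_right k hm
      have h3 : j ≤ j * m := Nat.le_mul_of_pos_right j hm
      rw [Nat.add_mul] at h1
      omega
    intro k l hkl
    rcases le_total k l with h1 | h1
    · exact key k l h1 hkl
    · exact (key l k h1 hkl.symm).symm
  adj k := by
    rw [← iterate_shift h 1 k]
    refine iterate_adj f _ ?_
    have h2 : k ≤ k * m := Nat.le_mul_of_pos_right k hm
    have h3 := C.adj ((k + 1) * m - (k + 1))
    have h4 : (k + 1) * m - (k + 1) + 1 = k * m - k + 1 * m := by
      rw [Nat.add_mul]; omega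
    rw [h4] at h3
    exact h3.symm

theorem iterate_vertex (hm : 0 < m) (h : ∀ n, f (C.vertex (n + m)) = C.vertex n) {j n : ℕ}
    (hn : n ≤ j * m) : f^[j] (C.vertex n) = (oppositeRay f C m hm h).vertex (j * m - n) := by
  change _ = f^[j * m - n] (C.vertex ((j * m - n) * m - (j * m - n)))
  have h1 : j * m - n ≤ (j * m - n) * m := Nat.le_mul_of_pos_right _ hm
  rcases le_total j (j * m - n) with h2 | h2
  · obtain ⟨i, hi⟩ := Nat.exists_eq_add_of_le h2
    have h3 := iterate_shift h i j n
    rw [hi, ← h3, Nat.add_mul]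
    congr 2
    omega
  · obtain ⟨i, hi⟩ := Nat.exists_eq_add_of_le h2
    have h3 := iterate_shift h i (j * m - n) ((j * m - n) * m - (j * m - n))
    rw [← hi] at h3
    rw [← h3]
    congr 2
    have : j * m = (j * m - n) * m + i * m := by
      rw [← Nat.add_mul, ← hi]
    omega

theorem endMap_iterate_mem_endsThrough (hT : T.IsTree) (f : T ↪g T) {u v : V} (h : T.Adj u v)
    {e : TreeEnd T} (he : e ∈ endsThrough T u v) (j : ℕ) :
    (endMap f)^[j] e ∈ endsThrough T (f^[j] u) (f^[j] v) := by
  induction j with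
  | zero => exact he
  | succ j ih =>
    simp only [Function.iterate_succ_apply']
    exact endMap_mem_endsThrough hT f (iterate_adj f j h) ih

/-- One end `e` of the `β`-th derivative, different from both ends of the double ray, is enough: its
images under the iterates of `f` accumulate at the opposite end. They never equal it, because that
end is fixed and `f` is injective on ends. -/
theorem oppositeRay_mem (hT : T.IsTree) (hm : 0 < m) (h : ∀ n, f (C.vertex (n + m)) = C.vertex n)
    (β : Ordinal.{u}) (hC : C.toEnd ∈ iteratedDerivedSet (Set.univ : Set (TreeEnd T)) β) :
    (oppositeRay f C m hm h).toEnd ∈ iteratedDerivedSet (Set.univ : Set (TreeEnd T)) β := by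
  induction β using Ordinal.limitRecOn with
  | zero => simp
  | limit a ha ih =>
    rw [iteratedDerivedSet_limit ha, Set.mem_iInter] at hC ⊢
    exact fun b => ih b.1 b.2 (hC b)
  | add_one β ih =>
    set Z := oppositeRay f C m hm h with hZ
    rw [mem_iteratedDerivedSet_succ hT] at hC ⊢
    refine ⟨fun n => ?_, ih hC.2⟩
    have hfix : ∀ j, (endMap f)^[j] Z.toEnd = Z.toEnd := by
      have h1 : endMap f Z.toEnd = Z.toEnd := by
        rw [endMap_toEnd, Ray.toEnd_eq_iff hT]
        refine ⟨0, m, fun n => ?_⟩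
        have h2 := iterate_vertex hm h (j := n) (n := n * m - n) (Nat.sub_le _ _)
        have h3 := iterate_vertex hm h (j := n + 1) (n := n * m - n)
          ((Nat.sub_le _ _).trans (Nat.mul_le_mul_right m (Nat.le_succ n)))
        have h4 : n ≤ n * m := Nat.le_mul_of_pos_right _ hm
        rw [Function.iterate_succ_apply', h2] at h3
        have e1 : n * m - (n * m - n) = 0 + n := by omega
        have e2 : (n + 1) * m - (n * m - n) = m + n := by rw [Nat.add_mul]; omega
        rw [e1, e2] at h3
        exact h3
      exact fun j => Function.iterate_fixed h1 j
    obtain ⟨e, he, hne, hthr⟩ := hC.1 0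
    -- The opposite ray starts at `x₀` and moves away from `x₁`, whereas `e` lies beyond the edge
    -- `x₀x₁`.
    have hneZ : e ≠ Z.toEnd := by
      rintro rfl
      refine endsThrough_disjoint hT (C.adj 0) hthr ?_
      have hz1 : ∀ k, T.dist (C.vertex (0 + 1)) (Z.vertex k) = k + 1 ∧
          T.dist (C.vertex 0) (Z.vertex k) = k := by
        intro k
        have h4 : k ≤ k * m := Nat.le_mul_of_pos_right _ hm
        have h5 := iterate_shift h k 0 0
        have h6 := iterate_shift h k 0 1
        rw [zero_add] at h5 h6
        rw [Function.iterate_zero_apply] at h5 h6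
        have hd : ∀ u v, T.dist (f^[k] u) (f^[k] v) = T.dist u v := by
          intro u v
          clear h5 h6
          generalize k = k
          induction k with
          | zero => rfl
          | succ k ih => rw [Function.iterate_succ_apply', Function.iterate_succ_apply',
              dist_embedding hT, ih]
        rw [← h5, ← h6]
        change T.dist _ (f^[k] (C.vertex (k * m - k))) = _ ∧
          T.dist _ (f^[k] (C.vertex (k * m - k))) = _
        rw [hd, hd, SimpleGraph.dist_comm, C.dist_vertex hT (by omega), SimpleGraph.dist_comm,
          C.dist_vertex hT (by omega)]
        omega
      refine (mem_endsThrough_adj hT (C.adj 0).symm).2 ⟨0, fun k _ => ?_⟩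
      rw [mem_half, SimpleGraph.dist_comm, SimpleGraph.dist_comm (v := C.vertex 0)]
      have := hz1 k
      omega
    obtain ⟨M, hM⟩ : ∃ M, e ∉ endsThrough T (C.vertex M) (C.vertex (M + 1)) := by
      by_contra! hall
      exact hne (eq_toEnd_of_forall_mem hT hall)
    have hM' := (endsThrough_or hT (C.adj M) e).resolve_left hM
    -- Applying `f` this often moves the edge `x_M x_{M+1}`, with `e` on its origin side, to an edge
    -- of the opposite ray of index at least `n`.
    let j := M + 1 + n
    have hj : M + 1 + n ≤ j * m := Nat.le_mul_of_pos_right _ hm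
    refine ⟨(endMap f)^[j] e, ?_, fun h1 => ?_, ?_⟩
    · clear_value j
      clear hj
      induction j with
      | zero => exact he
      | succ j ih => rw [Function.iterate_succ_apply']
                     exact endMap_mem_iteratedDerivedSet hT f _ _ ih
    · rw [← hfix j] at h1
      exact hneZ ((endMap_injective hT f).iterate j h1)
    · have h1 := endMap_iterate_mem_endsThrough hT f (C.adj M).symm hM' j
      rw [iterate_vertex hm h (show M + 1 ≤ j * m by omega),
        iterate_vertex hm h (show M ≤ j * m by omega)] at h1
      have h2 : j * m - M = j * m - (M + 1) + 1 := by omega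
      rw [h2] at h1
      exact endsThrough_vertex_anti hT Z (by omega) h1

theorem oppositeRay_ne (hT : T.IsTree) (hm : 0 < m)
    (h : ∀ n, f (C.vertex (n + m)) = C.vertex n) : (oppositeRay f C m hm h).toEnd ≠ C.toEnd := by
  intro he
  obtain ⟨a, b, hab⟩ := (Ray.toEnd_eq_iff hT).1 he
  have h1 : f^[a + 1] (C.vertex ((a + 1) * m - (a + 1))) = C.vertex (b + 1) := hab 1
  have h2 := iterate_shift h (a + 1) 0 (b + 1)
  rw [zero_add, Function.iterate_zero_apply] at h2
  rw [← h2] at h1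
  have h3 := C.injective ((f.injective.iterate _) h1)
  omega

end Backward

/-- In a scattered tree a unique end of maximal order is preserved forward by every embedding. -/
theorem preservedForwardBy_of_unique_maximal (hT : T.IsTree) (hs : IsScattered T) {e : TreeEnd T}
    (he : e.HasMaximalOrder) (hu : ∀ e' : TreeEnd T, e'.HasMaximalOrder → e' = e) (f : T ↪g T) :
    e.PreservedForwardBy f := by
  obtain ⟨α, hα, hmax⟩ := he
  have hmem := hα.mem
  have hfe : endMap f e = e := hu _ (hasMaximalOrder_of_mem hT hs hmax
    (endMap_mem_iteratedDerivedSet hT f α e hmem))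
  obtain ⟨r⟩ := hT.connected.nonempty
  obtain ⟨C, rfl, -⟩ := e.exists_ray hT r
  rw [endMap_toEnd] at hfe
  obtain ⟨a, b, hab⟩ := (Ray.toEnd_eq_iff hT).1 hfe
  have hab : ∀ n, f (C.vertex (a + n)) = C.vertex (b + n) := hab
  rcases le_or_gt a b with hle | hlt
  · refine ⟨C.tail a, C.toEnd_tail a, ?_⟩
    rintro _ ⟨_, ⟨n, rfl⟩, rfl⟩
    refine ⟨b - a + n, ?_⟩
    change C.vertex (a + (b - a + n)) = f (C.vertex (a + n))
    rw [hab]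
    congr 1
    omega
  -- Here `f` shifts a tail towards its origin by `a - b`, and the opposite end would be another end
  -- of maximal order.
  · exfalso
    have hm : 0 < a - b := by omega
    have h : ∀ n, f ((C.tail b).vertex (n + (a - b))) = (C.tail b).vertex n := by
      intro n
      change f (C.vertex (b + (n + (a - b)))) = C.vertex (b + n)
      have e1 : b + (n + (a - b)) = a + n := by omega
      rw [e1, hab]
    rw [← C.toEnd_tail b] at hmem hu
    exact oppositeRay_ne hT hm h (hu _ (hasMaximalOrder_of_mem hT hs hmax
      (oppositeRay_mem hT hm h α hmem)))

/-! ### Partial isometries of a tree -/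

/-- `φ` preserves the distances between the vertices of `S`. -/
def IsoOn (T : SimpleGraph V) (S : Set V) (φ : V → V) : Prop :=
  ∀ u ∈ S, ∀ v ∈ S, T.dist (φ u) (φ v) = T.dist u v

/-- There is a distance-preserving map from `S` to `S'` sending `a` to `a'`. -/
def Emb (T : SimpleGraph V) (S : Set V) (a : V) (S' : Set V) (a' : V) : Prop :=
  ∃ φ : V → V, IsoOn T S φ ∧ Set.MapsTo φ S S' ∧ φ a = a'

theorem Emb.of_subset {S S' : Set V} (h : S ⊆ S') (a : V) : Emb T S a S' a :=
  ⟨id, fun _ _ _ _ => rfl, h, rfl⟩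

theorem IsoOn.comp {S S' : Set V} {φ ψ : V → V} (h : IsoOn T S φ) (hm : Set.MapsTo φ S S')
    (h' : IsoOn T S' ψ) : IsoOn T S (ψ ∘ φ) := fun u hu v hv =>
  (h' _ (hm hu) _ (hm hv)).trans (h u hu v hv)

theorem IsoOn.mono {S S' : Set V} {φ : V → V} (h : IsoOn T S' φ) (hs : S ⊆ S') : IsoOn T S φ :=
  fun u hu v hv => h u (hs hu) v (hs hv)

theorem Emb.trans {S S' S'' : Set V} {a a' a'' : V} (h : Emb T S a S' a')
    (h' : Emb T S' a' S'' a'') : Emb T S a S'' a'' := by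
  obtain ⟨φ, h1, h2, h3⟩ := h
  obtain ⟨ψ, h4, h5, h6⟩ := h'
  exact ⟨ψ ∘ φ, h1.comp h2 h4, h5.comp h2, by rw [Function.comp_apply, h3, h6]⟩

theorem isoOn_embedding (hT : T.IsTree) (f : T ↪g T) (S : Set V) : IsoOn T S f :=
  fun u _ v _ => dist_embedding hT f u v

theorem IsoOn.injOn (hT : T.IsTree) {S : Set V} {φ : V → V} (h : IsoOn T S φ) :
    Set.InjOn φ S := by
  intro u hu v hv huv
  rw [← dist_eq_zero hT, ← h u hu v hv, huv, SimpleGraph.dist_self]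

theorem IsoOn.adj {S : Set V} {φ : V → V} (h : IsoOn T S φ) {u v : V} (hu : u ∈ S) (hv : v ∈ S)
    (ha : T.Adj u v) : T.Adj (φ u) (φ v) := by
  rw [← SimpleGraph.dist_eq_one_iff_adj, h u hu v hv, dist_adj ha]

/-- This is the return from metric maps, which restrict, compose and glue freely, to graph
embeddings. -/
theorem exists_embedding (hT : T.IsTree) {φ : V → V} (h : IsoOn T Set.univ φ) :
    ∃ f : T ↪g T, ∀ v, f v = φ v := by
  refine ⟨⟨⟨φ, fun u v huv => h.injOn hT trivial trivial huv⟩, ?_⟩, fun _ => rfl⟩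
  intro u v
  rw [← SimpleGraph.dist_eq_one_iff_adj, ← SimpleGraph.dist_eq_one_iff_adj]
  exact iff_of_eq (congrArg (· = 1) (h u trivial v trivial))

theorem IsoOn.mapsTo_half {S : Set V} {φ : V → V} (h : IsoOn T S φ) {u v : V} (hu : u ∈ S)
    (hv : v ∈ S) (hs : half T u v ⊆ S) : Set.MapsTo φ (half T u v) (half T (φ u) (φ v)) := by
  intro w hw
  rw [mem_half, h w (hs hw) u hu, h w (hs hw) v hv]
  exact hw

theorem IsoOn.emb_half {S : Set V} {φ : V → V} (h : IsoOn T S φ) {u v : V} (hu : u ∈ S)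
    (hv : v ∈ S) (hs : half T u v ⊆ S) : Emb T (half T u v) v (half T (φ u) (φ v)) (φ v) :=
  ⟨φ, h.mono hs, h.mapsTo_half hu hv hs, rfl⟩

theorem emb_half_embedding (hT : T.IsTree) (f : T ↪g T) (u v : V) :
    Emb T (half T u v) v (half T (f u) (f v)) (f v) :=
  (isoOn_embedding hT f Set.univ).emb_half trivial trivial (Set.subset_univ _)

/-! ### Pieces of a ray -/

theorem half_convex (hT : T.IsTree) {a b u v x : V} (h : T.Adj a b) (hu : u ∈ half T a b)
    (hv : v ∈ half T a b) (hx : T.dist u x + T.dist x v = T.dist u v) : x ∈ half T a b := by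
  rcases half_or hT h x with h1 | h1
  · exact h1
  · exfalso
    have h2 := dist_add_dist hT h h1 hu
    have h3 := dist_add_dist hT h h1 hv
    have h4 := hT.connected.dist_triangle (u := u) (v := b) (w := v)
    rw [SimpleGraph.dist_comm (u := u) (v := x)] at hx
    rw [SimpleGraph.dist_comm (u := u) (v := b)] at h4
    omega

theorem eq_of_crossing (hT : T.IsTree) {a b u v : V} (h : T.Adj a b) (hu : u ∈ half T b a)
    (hv : v ∈ half T a b) (huv : T.Adj u v) : v = b := by
  have := dist_add_dist hT h hu hv
  rw [dist_adj huv] at this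
  exact ((dist_eq_zero hT).1 (by omega)).symm

namespace Ray

/-- A walk can leave the region between the cut edges only by landing on a forbidden neighbour;
conversely the region is convex, so it contains the geodesic from `x_n`. The quantifier over `j`
makes the second cut vacuous at the origin. -/
theorem mem_piece (hT : T.IsTree) (C : Ray T) {n : ℕ} {w : V} :
    w ∈ C.piece n ↔ w ∈ C.back n ∧ ∀ j, j + 1 = n → w ∈ C.front j := by
  constructor
  · rintro ⟨p, hp⟩
    have key : ∀ {u w : V} (p : T.Walk u w), (∀ v ∈ p.support, v ∉ C.neighbours n) →
        (u ∈ C.back n ∧ ∀ j, j + 1 = n → u ∈ C.front j) →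
        w ∈ C.back n ∧ ∀ j, j + 1 = n → w ∈ C.front j := by
      intro u w p
      induction p with
      | nil => exact fun _ h => h
      | @cons u v w hadj p ih =>
        intro hp hu
        rw [SimpleGraph.Walk.support_cons] at hp
        have hv : v ∉ C.neighbours n := hp v (List.mem_cons_of_mem _ p.start_mem_support)
        refine ih (fun z hz => hp z (List.mem_cons_of_mem _ hz)) ⟨?_, ?_⟩
        · refine (C.back_or_front hT n v).resolve_right fun h => hv (Or.inl ?_)
          exact eq_of_crossing hT (C.adj n) hu.1 h hadj
        · intro j hj
          refine (C.back_or_front hT j v).resolve_left fun h => hv (Or.inr ⟨j, hj, ?_⟩)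
          exact eq_of_crossing hT (C.adj j).symm (hu.2 j hj) h hadj
    refine key p hp ⟨C.vertex_mem_back n, ?_⟩
    rintro j rfl
    exact C.vertex_mem_front j
  · rintro ⟨h1, h2⟩
    obtain ⟨p, hp⟩ := (hT.existsUnique_path (C.vertex n) w).exists
    refine ⟨p, fun v hv => ?_⟩
    rw [mem_support_iff hT hp] at hv
    rintro (rfl | ⟨j, rfl, rfl⟩)
    · have h3 : C.vertex (n + 1) ∈ C.back n :=
        half_convex hT (C.adj n).symm (C.vertex_mem_back n) h1 hv
      exact not_mem_half h3 (C.vertex_mem_front n)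
    · have h3 : C.vertex j ∈ C.front j :=
        half_convex hT (C.adj j) (C.vertex_mem_front j) (h2 j rfl) hv
      exact not_mem_half h3 (C.vertex_mem_back j)

theorem piece_subset_back (hT : T.IsTree) (C : Ray T) (n : ℕ) : C.piece n ⊆ C.back n :=
  fun _ h => ((C.mem_piece hT).1 h).1

theorem mem_piece_succ (hT : T.IsTree) (C : Ray T) {n : ℕ} {w : V} :
    w ∈ C.piece (n + 1) ↔ w ∈ C.back (n + 1) ∧ w ∈ C.front n := by
  rw [C.mem_piece hT]
  refine and_congr_right fun _ => ⟨fun h => h n rfl, ?_⟩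
  rintro h j hj
  obtain rfl := Nat.succ_injective hj
  exact h

theorem piece_convex (hT : T.IsTree) (C : Ray T) {n : ℕ} {u v x : V} (hu : u ∈ C.piece n)
    (hv : v ∈ C.piece n) (hx : T.dist u x + T.dist x v = T.dist u v) : x ∈ C.piece n := by
  rw [C.mem_piece hT] at *
  exact ⟨half_convex hT (C.adj n).symm hu.1 hv.1 hx,
    fun j hj => half_convex hT (C.adj j) (hu.2 j hj) (hv.2 j hj) hx⟩

/-- Pieces are convex, so paths inside a piece realise the distances of the whole tree. The values
outside the piece are irrelevant. -/
theorem PieceEmbeds.emb (hT : T.IsTree) {C : Ray T} {i j : ℕ} (h : C.PieceEmbeds i j) :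
    Emb T (C.piece i) (C.vertex i) (C.piece j) (C.vertex j) := by
  classical
  obtain ⟨g, hg⟩ := h
  refine ⟨fun w => if hw : w ∈ C.piece i then g ⟨w, hw⟩ else w, ?_, ?_, ?_⟩
  · intro u hu v hv
    simp only [hu, hv, dif_pos]
    obtain ⟨p, hp⟩ := (hT.existsUnique_path u v).exists
    have hps : ∀ x ∈ p.support, x ∈ C.piece i := fun x hx =>
      C.piece_convex hT hu hv ((mem_support_iff hT hp).1 hx)
    have hq : (p.induce _ hps).IsPath := by
      refine SimpleGraph.Walk.IsPath.of_map
        (f := (SimpleGraph.Embedding.induce (C.piece i) : _ ↪g T).toHom) ?_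
      exact (congrArg (fun q : T.Walk u v => q.IsPath) (SimpleGraph.Walk.map_induce p hps)).mpr hp
    have hr := (hq.map (f := g.toHom) g.injective).map
      (f := (SimpleGraph.Embedding.induce (C.piece j) : _ ↪g T).toHom)
      (SimpleGraph.Embedding.induce (C.piece j) : _ ↪g T).injective
    have hl := dist_of_isPath hT hr
    rw [SimpleGraph.Walk.length_map, SimpleGraph.Walk.length_map] at hl
    have hl' := congrArg SimpleGraph.Walk.length (SimpleGraph.Walk.map_induce p hps)
    rw [SimpleGraph.Walk.length_map] at hl'
    exact (hl.symm.trans hl').trans (dist_of_isPath hT hp)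
  · intro w hw
    simp only [hw, dif_pos]
    exact (g ⟨w, hw⟩).2
  · simp only [C.vertex_mem_piece i, dif_pos]
    exact congrArg Subtype.val hg

/-- The neighbours of `x_n` which are not on the ray. -/
def offNeighbours (C : Ray T) (n : ℕ) : Set V :=
  {y | T.Adj (C.vertex n) y ∧ y ∉ C.neighbours n}

theorem half_subset_back (hT : T.IsTree) (C : Ray T) {n : ℕ} {y : V} (h : T.Adj (C.vertex n) y)
    (hy : y ≠ C.vertex (n + 1)) : half T (C.vertex n) y ⊆ C.back n :=
  half_subset hT h (C.adj n) hy

theorem half_subset_piece (hT : T.IsTree) (C : Ray T) {n : ℕ} {y : V}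
    (hy : y ∈ C.offNeighbours n) : half T (C.vertex n) y ⊆ C.piece n := by
  intro w hw
  rw [C.mem_piece hT]
  refine ⟨C.half_subset_back hT hy.1 (fun h => hy.2 (Or.inl h)) hw, ?_⟩
  rintro j rfl
  exact half_subset hT hy.1 (C.adj j).symm (fun h => hy.2 (Or.inr ⟨j, rfl, h⟩)) hw

theorem mem_piece_of_off (hT : T.IsTree) (C : Ray T) {n : ℕ} {y : V}
    (hy : y ∈ C.offNeighbours n) : y ∈ C.piece n :=
  C.half_subset_piece hT hy (right_mem_half hy.1)

theorem off_of_mem_piece (hT : T.IsTree) (C : Ray T) {n : ℕ} {y : V} (hy : y ∈ C.piece n)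
    (h : T.Adj (C.vertex n) y) : y ∈ C.offNeighbours n := by
  refine ⟨h, ?_⟩
  rw [C.mem_piece hT] at hy
  rintro (rfl | ⟨j, rfl, rfl⟩)
  · exact not_mem_half hy.1 (C.vertex_mem_front n)
  · exact not_mem_half (hy.2 j rfl) (C.vertex_mem_back j)

/-- A rooted embedding between pieces acts on the branches at their roots. -/
theorem exists_branch_map (hT : T.IsTree) (C : Ray T) {i j : ℕ}
    (h : Emb T (C.piece i) (C.vertex i) (C.piece j) (C.vertex j)) :
    ∃ φ : V → V, Set.MapsTo φ (C.offNeighbours i) (C.offNeighbours j) ∧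
      Set.InjOn φ (C.offNeighbours i) ∧ ∀ y ∈ C.offNeighbours i,
        Emb T (half T (C.vertex i) y) y (half T (C.vertex j) (φ y)) (φ y) := by
  obtain ⟨φ, h1, h2, h3⟩ := h
  have hx := C.vertex_mem_piece i
  refine ⟨φ, fun y hy => ?_, fun y hy z hz hyz => ?_, fun y hy => ?_⟩
  · have hy' := C.mem_piece_of_off hT hy
    have := h1.adj hx hy' hy.1
    rw [h3] at this
    exact C.off_of_mem_piece hT (h2 hy') this
  · exact h1.injOn hT (C.mem_piece_of_off hT hy) (C.mem_piece_of_off hT hz) hyz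
  · have := h1.emb_half hx (C.mem_piece_of_off hT hy) (C.half_subset_piece hT hy)
    rwa [h3] at this

end Ray

/-! ### Gluing -/

/-- Rooted embeddings of the branches at a vertex glue together. -/
theorem exists_isoOn_of_branches (hT : T.IsTree) {x x' : V} {N S : Set V} {ι : V → V}
    (hN : ∀ y ∈ N, T.Adj x y) (hN' : ∀ y ∈ N, T.Adj x' (ι y)) (hι : Set.InjOn ι N)
    (hS : ∀ w ∈ S, w = x ∨ ∃ y ∈ N, w ∈ half T x y)
    (h : ∀ y ∈ N, Emb T (half T x y) y (half T x' (ι y)) (ι y)) :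
    ∃ φ : V → V, IsoOn T S φ ∧ φ x = x' ∧
      ∀ w ∈ S, w = x ∨ ∃ y ∈ N, φ w ∈ half T x' (ι y) := by
  classical
  choose! ψ h1 h2 h3 using h
  have hS' : ∀ w, ∃ y, w ∈ S → w ≠ x → y ∈ N ∧ w ∈ half T x y := by
    intro w
    by_cases hw : w ∈ S ∧ w ≠ x
    · obtain ⟨y, h4, h5⟩ := (hS w hw.1).resolve_left hw.2
      exact ⟨y, fun _ _ => ⟨h4, h5⟩⟩
    · exact ⟨x, fun h4 h5 => absurd ⟨h4, h5⟩ hw⟩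
  choose b hb using hS'
  let φ : V → V := fun w => if w = x then x' else ψ (b w) w
  have hx : φ x = x' := if_pos rfl
  have hφ : ∀ w, w ≠ x → φ w = ψ (b w) w := fun w hw => if_neg hw
  have hmem : ∀ w ∈ S, w ≠ x → φ w ∈ half T x' (ι (b w)) := by
    intro w hw hwx
    obtain ⟨h4, h5⟩ := hb w hw hwx
    rw [hφ w hwx]
    exact h2 _ h4 h5
  have hroot : ∀ w ∈ S, T.dist (φ w) x' = T.dist w x := by
    intro w hw
    by_cases hwx : w = x
    · rw [hwx, hx, SimpleGraph.dist_self, SimpleGraph.dist_self]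
    · obtain ⟨h4, h5⟩ := hb w hw hwx
      have h6 := hmem w hw hwx
      rw [mem_half] at h6
      rw [h6, hφ w hwx, ← h3 _ h4, h1 _ h4 _ h5 _ (right_mem_half (hN _ h4)), mem_half.1 h5]
  refine ⟨φ, ?_, hx, fun w hw => ?_⟩
  · intro u hu v hv
    by_cases hux : u = x
    · rw [hux, hx, SimpleGraph.dist_comm, hroot v hv, SimpleGraph.dist_comm]
    by_cases hvx : v = x
    · rw [hvx, hx, hroot u hu]
    obtain ⟨h4, h5⟩ := hb u hu hux
    obtain ⟨h6, h7⟩ := hb v hv hvx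
    by_cases hbb : b u = b v
    · rw [hφ u hux, hφ v hvx, hbb]
      exact h1 _ h6 _ (hbb ▸ h5) _ h7
    · have h8 := dist_branches hT (hN _ h4) h5
        (half_disjoint_of_ne hT (hN _ h6) (hN _ h4) (Ne.symm hbb) h7)
      have hne : ι (b v) ≠ ι (b u) := fun h => hbb (hι h4 h6 h.symm)
      have h9 := dist_branches hT (hN' _ h4) (hmem u hu hux)
        (half_disjoint_of_ne hT (hN' _ h6) (hN' _ h4) hne (hmem v hv hvx))
      rw [h9, h8, hroot u hu, SimpleGraph.dist_comm (u := x'), hroot v hv,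
        SimpleGraph.dist_comm (u := v)]
  · by_cases hwx : w = x
    · exact Or.inl hwx
    · exact Or.inr ⟨b w, (hb w hw hwx).1, hmem w hw hwx⟩

namespace Ray

/-- If the branch of the origin can be absorbed into a chain of branches off the ray, then the
whole part of the origin embeds into a piece. -/
theorem emb_back_piece (hT : T.IsTree) (C : Ray T) {i : ℕ} {F : ℕ → V}
    (h0 : F 0 = C.vertex i) (hoff : ∀ j, F (j + 1) ∈ C.offNeighbours (i + 1))
    (hinj : Function.Injective F)
    (hemb : ∀ j, Emb T (half T (C.vertex (i + 1)) (F j)) (F j)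
      (half T (C.vertex (i + 1)) (F (j + 1))) (F (j + 1))) :
    Emb T (C.back (i + 1)) (C.vertex (i + 1)) (C.piece (i + 1)) (C.vertex (i + 1)) := by
  classical
  let N : Set V := {y | T.Adj (C.vertex (i + 1)) y ∧ y ≠ C.vertex (i + 2)}
  -- Hilbert's hotel: `F j` moves to `F (j + 1)` and every other branch stays. This vacates `F 0`,
  -- the branch of the origin.
  have hιex : ∀ y, ∃ z, (∀ j, y = F j → z = F (j + 1)) ∧ ((∀ j, y ≠ F j) → z = y) := by
    intro y
    by_cases hy : ∃ j, y = F j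
    · obtain ⟨j, rfl⟩ := hy
      exact ⟨F (j + 1), fun k hk => by rw [hinj hk], fun h => absurd rfl (h j)⟩
    · push Not at hy
      exact ⟨y, fun j hj => absurd hj (hy j), fun _ => rfl⟩
  choose ι hι1 hι2 using hιex
  have hιoff : ∀ y ∈ N, ι y ∈ C.offNeighbours (i + 1) := by
    intro y hy
    by_cases hyF : ∃ j, y = F j
    · obtain ⟨j, hj⟩ := hyF
      rw [hι1 y j hj]
      exact hoff j
    · push Not at hyF
      rw [hι2 y hyF]
      refine ⟨hy.1, ?_⟩
      rintro (h | ⟨j, hj, h⟩)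
      · exact hy.2 h
      · obtain rfl := Nat.succ_injective hj
        exact hyF 0 (h.trans h0.symm)
  have hιinj : Function.Injective ι := by
    intro y z hyz
    by_cases hyF : ∃ j, y = F j <;> by_cases hzF : ∃ j, z = F j
    · obtain ⟨j, hj⟩ := hyF
      obtain ⟨k, hk⟩ := hzF
      rw [hι1 y j hj, hι1 z k hk] at hyz
      rw [hj, hk, Nat.succ_injective (hinj hyz)]
    · obtain ⟨j, hj⟩ := hyF
      push Not at hzF
      rw [hι1 y j hj, hι2 z hzF] at hyz
      exact absurd hyz.symm (hzF _)
    · obtain ⟨k, hk⟩ := hzF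
      push Not at hyF
      rw [hι1 z k hk, hι2 y hyF] at hyz
      exact absurd hyz (hyF _)
    · push Not at hyF hzF
      rwa [hι2 y hyF, hι2 z hzF] at hyz
  obtain ⟨φ, h1, h2, h3⟩ := exists_isoOn_of_branches hT (x := C.vertex (i + 1))
    (x' := C.vertex (i + 1)) (N := N) (S := C.back (i + 1)) (ι := ι) (fun y hy => hy.1)
    (fun y hy => (hιoff y hy).1) hιinj.injOn
    (fun w hw => by
      by_cases hwx : w = C.vertex (i + 1)
      · exact Or.inl hwx
      · obtain ⟨y, hy, hd⟩ := exists_closer hT (Ne.symm hwx)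
        refine Or.inr ⟨y, ⟨hy, ?_⟩, hd⟩
        rintro rfl
        exact not_mem_half hw hd)
    (fun y hy => by
      by_cases hyF : ∃ j, y = F j
      · obtain ⟨j, hj⟩ := hyF
        rw [hι1 y j hj, hj]
        exact hemb j
      · push Not at hyF
        rw [hι2 y hyF]
        exact Emb.of_subset subset_rfl _)
  refine ⟨φ, h1, fun w hw => ?_, h2⟩
  rcases h3 w hw with h4 | ⟨y, hy, h4⟩
  · rw [h4, h2]
    exact C.vertex_mem_piece _
  · exact C.half_subset_piece hT (hιoff y hy) h4

/-- Rooted embeddings of the parts of a tree along a ray glue to an embedding which shifts the ray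
towards its origin. -/
theorem exists_backward_shift (hT : T.IsTree) (C : Ray T) {i s : ℕ}
    (h0 : Emb T (C.back (i + s)) (C.vertex (i + s)) (C.back i) (C.vertex i))
    (h : ∀ n, i < n → Emb T (C.piece (n + s)) (C.vertex (n + s)) (C.piece n) (C.vertex n)) :
    ∃ f : T ↪g T, ∀ n, i < n → f (C.vertex (n + s)) = C.vertex n := by
  classical
  let S : ℕ → Set V := fun n => {w | w ∈ C.back n ∧ ∀ j, j + 1 = n → i < n → w ∈ C.front j}
  -- The tree is tiled by `back (i + s)` (for `n = i`) and the pieces `n + s` with `n > i`. The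
  -- guard `i < n` lets one formula describe both kinds of tile.
  have hψ : ∀ n, ∃ ψ : V → V, i ≤ n → IsoOn T {w | w ∈ C.back (n + s) ∧
      ∀ j, j + 1 = n → i < n → w ∈ C.front (j + s)} ψ ∧ (∀ w, w ∈ C.back (n + s) →
      (∀ j, j + 1 = n → i < n → w ∈ C.front (j + s)) → ψ w ∈ C.back n ∧
      ∀ j, j + 1 = n → i < n → ψ w ∈ C.front j) ∧ ψ (C.vertex (n + s)) = C.vertex n := by
    intro n
    by_cases hin : i < n
    · obtain ⟨j, rfl⟩ := Nat.exists_eq_add_of_le' (Nat.one_le_of_lt hin)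
      obtain ⟨ψ, h1, h2, h3⟩ := h (j + 1) hin
      have e : j + 1 + s = j + s + 1 := by omega
      have hp : ∀ w, w ∈ C.back (j + 1 + s) → (∀ k, k + 1 = j + 1 → i < j + 1 →
          w ∈ C.front (k + s)) → w ∈ C.piece (j + 1 + s) := by
        intro w hw hw'
        rw [e] at hw ⊢
        exact (C.mem_piece_succ hT).2 ⟨hw, hw' j rfl hin⟩
      refine ⟨ψ, fun _ => ⟨h1.mono fun w hw => hp w hw.1 hw.2, fun w hw hw' => ?_, h3⟩⟩
      have h4 := (C.mem_piece_succ hT).1 (h2 (hp w hw hw'))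
      refine ⟨h4.1, ?_⟩
      rintro k hk -
      obtain rfl := Nat.succ_injective hk
      exact h4.2
    · obtain ⟨ψ, h1, h2, h3⟩ := h0
      refine ⟨ψ, fun hn => ?_⟩
      obtain rfl : i = n := le_antisymm hn (not_lt.1 hin)
      exact ⟨h1.mono fun w hw => hw.1, fun w hw _ => ⟨h2 hw, fun _ _ h => absurd h hin⟩, h3⟩
  choose ψ hψ using hψ
  have hν : ∀ w, ∃ n, i ≤ n ∧ w ∈ C.back (n + s) ∧
      ∀ j, j + 1 = n → i < n → w ∈ C.front (j + s) := by
    intro w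
    have hex : ∃ n, i ≤ n ∧ w ∈ C.back (n + s) := by
      obtain ⟨n, hn⟩ := C.exists_mem_back hT w
      exact ⟨n + i, by omega, C.back_mono hT (by omega) hn⟩
    refine ⟨Nat.find hex, (Nat.find_spec hex).1, (Nat.find_spec hex).2, fun j hj hi => ?_⟩
    have := Nat.find_min hex (m := j) (by omega)
    refine (C.back_or_front hT (j + s) w).resolve_left fun hb => this ⟨by omega, hb⟩
  choose ν hν1 hν2 hν3 using hν
  let φ : V → V := fun w => ψ (ν w) w
  have hb : ∀ w, φ w ∈ C.back (ν w) ∧ ∀ j, j + 1 = ν w → i < ν w → φ w ∈ C.front j :=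
    fun w => (hψ (ν w) (hν1 w)).2.1 w (hν2 w) (hν3 w)
  have hvert : ∀ n, ∀ j, j + 1 = n → i < n → C.vertex (n + s) ∈ C.front (j + s) :=
    fun n j hj _ => C.vertex_mem_front_of_lt hT (by omega)
  have hroot : ∀ w, T.dist (φ w) (C.vertex (ν w)) = T.dist w (C.vertex (ν w + s)) := by
    intro w
    rw [← (hψ (ν w) (hν1 w)).2.2]
    exact (hψ (ν w) (hν1 w)).1 w ⟨hν2 w, hν3 w⟩ _ ⟨C.vertex_mem_back _, hvert _⟩
  -- A geodesic between different tiles runs along the ray from root to root, and the shift keeps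
  -- the difference of the indices.
  have hlt : ∀ u v, ν u < ν v → T.dist (φ u) (φ v) = T.dist u v := by
    intro u v huv
    obtain ⟨j, hj⟩ := Nat.exists_eq_add_of_le' (Nat.one_le_of_lt huv)
    have hi : i < ν v := (hν1 u).trans_lt huv
    have h1 := C.dist_back_front hT (hν2 u) (hν3 v j hj.symm hi) (by omega)
    have h2 := C.dist_back_front hT (hb u).1 ((hb v).2 j hj.symm hi) (by omega)
    have h3 := hroot u
    have h4 := hroot v
    have e : j + s + 1 = ν v + s := by omega
    rw [e, SimpleGraph.dist_comm (u := C.vertex _)] at h1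
    rw [← hj, SimpleGraph.dist_comm (u := C.vertex _)] at h2
    omega
  have hiso : IsoOn T Set.univ φ := by
    intro u _ v _
    rcases lt_trichotomy (ν u) (ν v) with huv | huv | huv
    · exact hlt u v huv
    · have h1 := (hψ (ν v) (hν1 v)).1 u ⟨huv ▸ hν2 u, huv ▸ hν3 u⟩ v ⟨hν2 v, hν3 v⟩
      change T.dist (ψ (ν u) u) (ψ (ν v) v) = _
      rw [huv]
      exact h1
    · rw [SimpleGraph.dist_comm, hlt v u huv, SimpleGraph.dist_comm]
  obtain ⟨f, hf⟩ := exists_embedding hT hiso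
  refine ⟨f, fun n hn => ?_⟩
  rw [hf]
  have : ν (C.vertex (n + s)) = n := by
    have h1 := hν2 (C.vertex (n + s))
    have h2 := hν3 (C.vertex (n + s))
    by_contra hne
    rcases lt_or_gt_of_ne hne with h3 | h3
    · exact not_mem_half h1 (C.vertex_mem_front_of_lt hT (by omega))
    · obtain ⟨j, hj⟩ := Nat.exists_eq_add_of_le' (Nat.one_le_of_lt h3)
      exact not_mem_half (h2 j hj.symm (hn.trans h3)) (C.vertex_mem_back_of_le hT (by omega))
  change ψ (ν (C.vertex (n + s))) (C.vertex (n + s)) = _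
  rw [this]
  exact (hψ n hn.le).2.2

end Ray

/-! ### Embeddings shifting a ray -/

namespace Ray

/-- `f` shifts the vertices of `C` far from the origin by `l`. -/
def ShiftedBy (C : Ray T) (f : T ↪g T) (l : ℕ) : Prop :=
  ∃ N, ∀ n, N ≤ n → f (C.vertex n) = C.vertex (n + l)

/-- `M` is the last index at which `f` does not act on `C` as the shift by `l`. -/
def LastFailure (C : Ray T) (f : T ↪g T) (l M : ℕ) : Prop :=
  (∀ n, M < n → f (C.vertex n) = C.vertex (n + l)) ∧ f (C.vertex M) ≠ C.vertex (M + l)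

/-- The rooted tree at `x_i` embeds isometrically into the one at `x_j`. -/
def PieceEmb (C : Ray T) (i j : ℕ) : Prop :=
  Emb T (C.piece i) (C.vertex i) (C.piece j) (C.vertex j)

/-- The part of the origin at `x_i`, rooted at `x_i`, embeds into the one at `x_j`. -/
def BackEmb (C : Ray T) (i j : ℕ) : Prop :=
  Emb T (C.back i) (C.vertex i) (C.back j) (C.vertex j)

theorem exists_shiftedBy (hT : T.IsTree) (C : Ray T) {f : T ↪g T}
    (h : C.toEnd.PreservedForwardBy f) : ∃ l, C.ShiftedBy f l := by
  obtain ⟨D, hD, hfD⟩ := h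
  have hsub : (D.map f).verts ⊆ D.verts := by
    rintro _ ⟨n, rfl⟩
    exact hfD ⟨_, ⟨n, rfl⟩, rfl⟩
  obtain ⟨l, hl⟩ := eq_shift_of_verts_subset hT hsub
  have hl : ∀ n, f (D.vertex n) = D.vertex (l + n) := hl
  obtain ⟨a, b, hab⟩ := (toEnd_eq_iff hT).1 hD
  refine ⟨l, b, fun n hn => ?_⟩
  obtain ⟨k, rfl⟩ := Nat.exists_eq_add_of_le hn
  rw [← hab, hl, add_assoc b, ← hab]
  congr 1
  omega

/-- A forward shift valid from `N` on would preserve the tail at `N`, so some failure occurs at or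
after `N`; eventual shifting makes a last one exist. -/
theorem exists_lastFailure {C : Ray T} {f : T ↪g T} {l N : ℕ} (h : C.ShiftedBy f l)
    (hN : ¬ (C.tail N).PreservedBy f) : ∃ M, N ≤ M ∧ C.LastFailure f l M := by
  classical
  have hex : ∃ K, ∀ n, K ≤ n → f (C.vertex n) = C.vertex (n + l) := h
  have h1 : N < Nat.find hex := by
    by_contra! hle
    refine hN ?_
    rintro _ ⟨_, ⟨n, rfl⟩, rfl⟩
    refine ⟨n + l, ?_⟩
    change C.vertex (N + (n + l)) = f (C.vertex (N + n))
    rw [Nat.find_spec hex (N + n) (by omega), add_assoc]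
  obtain ⟨M, hM⟩ := Nat.exists_eq_add_of_le' (Nat.one_le_of_lt h1)
  refine ⟨M, by omega, fun n hn => Nat.find_spec hex n (by omega), fun hf => ?_⟩
  refine Nat.find_min hex (m := M) (by omega) fun n hn => ?_
  rcases hn.eq_or_lt with rfl | hlt
  · exact hf
  · exact Nat.find_spec hex n (by omega)

theorem backEmb_of_shift (hT : T.IsTree) {C : Ray T} {f : T ↪g T} {l M : ℕ}
    (h : ∀ n, M < n → f (C.vertex n) = C.vertex (n + l)) {n : ℕ} (hn : M < n) :
    C.BackEmb n (n + l) := by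
  have h1 := emb_half_embedding hT f (C.vertex (n + 1)) (C.vertex n)
  rw [h _ hn, h (n + 1) (by omega), Nat.add_right_comm] at h1
  exact h1

theorem pieceEmb_of_shift (hT : T.IsTree) {C : Ray T} {f : T ↪g T} {l M : ℕ}
    (h : ∀ n, M < n → f (C.vertex n) = C.vertex (n + l)) {n : ℕ} (hn : M + 1 < n) :
    C.PieceEmb n (n + l) := by
  obtain ⟨j, rfl⟩ := Nat.exists_eq_add_of_le' (Nat.one_le_of_lt hn)
  refine ⟨f, isoOn_embedding hT f _, fun w hw => ?_, h _ (by omega)⟩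
  rw [Nat.add_right_comm, C.mem_piece_succ hT]
  rw [C.mem_piece_succ hT] at hw
  have h1 := map_mem_half hT f hw.1
  have h2 := map_mem_half hT f hw.2
  rw [h _ (by omega), h _ (by omega)] at h1 h2
  have e1 : j + 1 + 1 + l = j + l + 1 + 1 := by omega
  have e2 : j + 1 + l = j + l + 1 := by omega
  rw [e1, e2] at h1
  rw [e2] at h2
  exact ⟨h1, h2⟩

theorem ShiftedBy.exists_emb (hT : T.IsTree) {C : Ray T} {f : T ↪g T} {l : ℕ}
    (h : C.ShiftedBy f l) : ∃ N, ∀ n, N ≤ n → C.BackEmb n (n + l) ∧ C.PieceEmb n (n + l) := by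
  obtain ⟨N, hN⟩ := h
  have hN' : ∀ n, N < n → f (C.vertex n) = C.vertex (n + l) := fun n hn => hN n hn.le
  exact ⟨N + 2, fun n hn => ⟨backEmb_of_shift hT hN' (by omega), pieceEmb_of_shift hT hN' (by omega)⟩⟩

/-- The forward neighbour of the image of `x_{M+1}` is already the image of `x_{M+2}`. A branch can
therefore stay on the ray only by landing on `x_{M+l}`, and by the failure at `M` the branch of the
origin does not do so. -/
theorem LastFailure.mem_off {C : Ray T} {f : T ↪g T} {l M : ℕ} (h : C.LastFailure f l M) {y : V}
    (hy : T.Adj (C.vertex (M + 1)) y) (hy' : y ≠ C.vertex (M + 2)) (hne : f y ≠ C.vertex (M + l)) :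
    f y ∈ C.offNeighbours (M + 1 + l) := by
  refine ⟨?_, ?_⟩
  · rw [← h.1 _ (Nat.lt_succ_self M)]
    exact f.map_adj_iff.2 hy
  · rintro (h1 | ⟨j, hj, h1⟩)
    · have e : M + 1 + l + 1 = M + 2 + l := by omega
      rw [e, ← h.1 (M + 2) (by omega)] at h1
      exact hy' (f.injective h1)
    · obtain rfl : j = M + l := by omega
      exact hne h1

theorem LastFailure.emb_half (hT : T.IsTree) {C : Ray T} {f : T ↪g T} {l M : ℕ}
    (h : C.LastFailure f l M) (y : V) :
    Emb T (half T (C.vertex (M + 1)) y) y (half T (C.vertex (M + 1 + l)) (f y)) (f y) := by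
  have := emb_half_embedding hT f (C.vertex (M + 1)) y
  rwa [h.1 _ (Nat.lt_succ_self M)] at this

theorem LastFailure.vertex_mem_off {C : Ray T} {f : T ↪g T} {l M : ℕ} (h : C.LastFailure f l M) :
    f (C.vertex M) ∈ C.offNeighbours (M + 1 + l) := by
  refine h.mem_off (C.adj M).symm (fun h1 => ?_) h.2
  have := C.injective h1
  omega

end Ray

/-! ### Regular rays are eventually periodic -/

theorem exists_recurrent {α : Type*} (c : ℕ → α) (S : Finset α) (hc : ∀ n, c n ∈ S) :
    ∃ N, ∀ n, N ≤ n → ∀ K, ∃ m, K ≤ m ∧ c m = c n := by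
  classical
  have h : ∀ᶠ n in Filter.atTop, ∀ a ∈ S, (∃ᶠ m in Filter.atTop, c m = a) ∨ c n ≠ a := by
    rw [Filter.eventually_all_finset]
    intro a _
    by_cases ha : ∃ᶠ m in Filter.atTop, c m = a
    · exact Filter.Eventually.of_forall fun _ => Or.inl ha
    · filter_upwards [Filter.not_frequently.1 ha] with n hn
      exact Or.inr hn
  obtain ⟨N, hN⟩ := Filter.eventually_atTop.1 h
  refine ⟨N, fun n hn K => ?_⟩
  have h1 := (hN n hn (c n) (hc n)).resolve_right fun h => h rfl
  obtain ⟨m, h2, h3⟩ := Filter.frequently_atTop.1 h1 K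
  exact ⟨m, h2, h3⟩

theorem exists_frequently_fiber {α : Type*} (c : ℕ → α) (S : Finset α) (hc : ∀ n, c n ∈ S)
    {P : ℕ → Prop} (hP : ∀ K, ∃ m, K ≤ m ∧ P m) : ∃ a, ∀ K, ∃ m, K ≤ m ∧ P m ∧ c m = a := by
  by_contra! h
  choose K hK using h
  obtain ⟨m, h1, h2⟩ := hP (S.sup K)
  exact hK (c m) m ((Finset.le_sup (hc m)).trans h1) h2 rfl

theorem chain_of_step {E : ℕ → ℕ → Prop} (hrefl : ∀ n, E n n)
    (htrans : ∀ {a b c}, E a b → E b c → E a c) {N k : ℕ} (h : ∀ n, N ≤ n → E n (n + k))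
    (t : ℕ) {n : ℕ} (hn : N ≤ n) : E n (n + t * k) := by
  induction t with
  | zero => simpa using hrefl n
  | succ t ih =>
    rw [Nat.succ_mul, ← add_assoc]
    exact htrans ih (h _ (by omega))

/-- Along a residue class the relation ascends, but with finitely many classes every late class
recurs; a recurrence of the class of `n` after `n + k` closes the loop. -/
theorem exists_periodic {E : ℕ → ℕ → Prop} (hrefl : ∀ n, E n n)
    (htrans : ∀ {a b c}, E a b → E b c → E a c) {F : Finset ℕ}
    (hF : ∀ i, ∃ j ∈ F, E i j ∧ E j i) {N k : ℕ} (hk : 0 < k) (h : ∀ n, N ≤ n → E n (n + k)) :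
    ∃ N', ∀ n, N' ≤ n → E n (n + k) ∧ E (n + k) n := by
  choose ρ h1 h2 h3 using hF
  obtain ⟨N', hN'⟩ := exists_recurrent (fun n => (n % k, ρ n)) (Finset.range k ×ˢ F)
    (fun n => Finset.mk_mem_product (Finset.mem_range.2 (Nat.mod_lt n hk)) (h1 n))
  refine ⟨max N N', fun n hn => ⟨h n (by omega), ?_⟩⟩
  obtain ⟨m, hm, hc⟩ := hN' n (by omega) (n + k)
  obtain ⟨hmod, hρ⟩ := Prod.mk.inj hc
  obtain ⟨d, rfl⟩ := Nat.exists_eq_add_of_le hm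
  have hd : k ∣ d := by
    have h4 : n ≡ n + (k + d) [MOD k] := by rw [← add_assoc]; exact hmod.symm
    have h5 := (Nat.modEq_iff_dvd' (Nat.le_add_right n (k + d))).1 h4
    rw [Nat.add_sub_cancel_left] at h5
    exact (Nat.dvd_add_right (dvd_refl k)).1 h5
  obtain ⟨t, rfl⟩ := hd
  have h6 := chain_of_step hrefl htrans h t (n := n + k) (by omega)
  rw [mul_comm] at h6
  exact htrans h6 (htrans (h2 _) (hρ ▸ h3 n))

/-- Any other shift length `l` inherits the threshold `N'`: move up by multiples of `k`, use `l`
there, and come back. Conversely, `k` steps of length `l` are `l` steps of length `k`. The bound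
does not depend on where `l` starts to work, which gives uniformity over all embeddings. -/
theorem periodic_of_eventually {E : ℕ → ℕ → Prop} (hrefl : ∀ n, E n n)
    (htrans : ∀ {a b c}, E a b → E b c → E a c) {N' N k l : ℕ} (hk : 0 < k)
    (h : ∀ n, N' ≤ n → E n (n + k) ∧ E (n + k) n) (hl : ∀ n, N ≤ n → E n (n + l)) {n : ℕ}
    (hn : N' ≤ n) : E n (n + l) ∧ E (n + l) n := by
  have up : ∀ t n, N' ≤ n → E n (n + t * k) := fun t n hn =>
    chain_of_step hrefl htrans (fun n hn => (h n hn).1) t hn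
  have down : ∀ t n, N' ≤ n → E (n + t * k) n := fun t n hn =>
    chain_of_step (E := fun a b => E b a) hrefl (fun h1 h2 => htrans h2 h1)
      (fun n hn => (h n hn).2) t hn
  have key : ∀ n, N' ≤ n → E n (n + l) := by
    intro n hn
    have h1 : N ≤ n + N * k := le_add_left (Nat.le_mul_of_pos_right N hk)
    refine htrans (up N n hn) (htrans (hl _ h1) ?_)
    rw [add_right_comm]
    exact down N (n + l) (by omega)
  refine ⟨key n hn, ?_⟩
  obtain ⟨k, rfl⟩ := Nat.exists_eq_add_of_le' hk
  have h1 := chain_of_step hrefl htrans key k (n := n + l) (by omega)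
  have h2 := down l n hn
  have e : n + l * (k + 1) = n + l + k * l := by ring
  rw [e] at h2
  exact htrans h1 h2

/-! ### Regular ends which are moved by some embedding -/

namespace Ray

theorem PieceEmb.refl (C : Ray T) (n : ℕ) : C.PieceEmb n n := Emb.of_subset subset_rfl _

theorem BackEmb.refl (C : Ray T) (n : ℕ) : C.BackEmb n n := Emb.of_subset subset_rfl _

/-- Such a map would glue with the maps between pieces to an embedding that shifts the ray towards
its origin, but every embedding shifts it forwards. -/
theorem not_backEmb (hT : T.IsTree) {C : Ray T} (hC : ∀ f : T ↪g T, ∃ l, C.ShiftedBy f l)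
    {i s : ℕ} (hs : 0 < s) (hp : ∀ n, i < n → C.PieceEmb (n + s) n) : ¬ C.BackEmb (i + s) i := by
  intro hb
  obtain ⟨f, hf⟩ := C.exists_backward_shift hT hb hp
  obtain ⟨l, N, hl⟩ := hC f
  have h1 := hf (i + 1 + N) (by omega)
  rw [hl _ (by omega)] at h1
  have := C.injective h1
  omega

/-- Following the branch of the origin under an embedding which fails to preserve the ray, one
either obtains an infinite chain of branches at a vertex, or a branch between two parts of the
origin. -/
theorem LastFailure.chain_or_between (hT : T.IsTree) {C : Ray T} {g : T ↪g T} {l M i : ℕ}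
    (h : C.LastFailure g l M) (h1 : C.PieceEmb (i + 1) (M + 1))
    (h2 : C.PieceEmb (M + 1 + l) (i + 1)) :
    (∃ z : ℕ → V, Function.Injective z ∧ (∀ j, z j ∈ C.offNeighbours (i + 1)) ∧
      Emb T (C.back M) (C.vertex M) (half T (C.vertex (i + 1)) (z 0)) (z 0) ∧
      ∀ j, Emb T (half T (C.vertex (i + 1)) (z j)) (z j)
        (half T (C.vertex (i + 1)) (z (j + 1))) (z (j + 1))) ∨
    ∃ D ∈ C.offNeighbours (i + 1),
      Emb T (C.back M) (C.vertex M) (half T (C.vertex (i + 1)) D) D ∧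
      Emb T (half T (C.vertex (i + 1)) D) D (C.back (M + l)) (C.vertex (M + l)) := by
  classical
  obtain ⟨φ, hφ1, hφ2, hφ3⟩ := C.exists_branch_map hT h1
  obtain ⟨ψ, hψ1, hψ2, hψ3⟩ := C.exists_branch_map hT h2
  -- Carry a branch at `x_{i+1}` to `x_{M+1}`, apply `g`, and carry the result back. The orbit
  -- starts with the image of the branch of the origin and can only be interrupted by a branch that
  -- `g` sends onto `x_{M+l}`.
  let G : V → V := fun z => ψ (g (φ z))
  let z : ℕ → V := fun j => G^[j] (ψ (g (C.vertex M)))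
  have hzs : ∀ j, z (j + 1) = ψ (g (φ (z j))) := fun j => Function.iterate_succ_apply' G j _
  have hoff : ∀ y ∈ C.offNeighbours (i + 1), g (φ y) ≠ C.vertex (M + l) →
      g (φ y) ∈ C.offNeighbours (M + 1 + l) := fun y hy hne =>
    h.mem_off (hφ1 hy).1 (fun h3 => (hφ1 hy).2 (Or.inl h3)) hne
  have hz0 : z 0 ∈ C.offNeighbours (i + 1) := hψ1 h.vertex_mem_off
  have hemb0 : Emb T (C.back M) (C.vertex M) (half T (C.vertex (i + 1)) (z 0)) (z 0) :=
    (h.emb_half hT (C.vertex M)).trans (hψ3 _ h.vertex_mem_off)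
  have hstep : ∀ y ∈ C.offNeighbours (i + 1), Emb T (half T (C.vertex (i + 1)) y) y
      (half T (C.vertex (M + 1 + l)) (g (φ y))) (g (φ y)) := fun y hy =>
    (hφ3 y hy).trans (h.emb_half hT _)
  have hmem : ∀ j, (∀ k < j, g (φ (z k)) ≠ C.vertex (M + l)) →
      z j ∈ C.offNeighbours (i + 1) ∧
      Emb T (C.back M) (C.vertex M) (half T (C.vertex (i + 1)) (z j)) (z j) := by
    intro j
    induction j with
    | zero => exact fun _ => ⟨hz0, hemb0⟩
    | succ j ih =>
      intro hk
      obtain ⟨h3, h4⟩ := ih fun k hkj => hk k (by omega)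
      have h5 := hoff _ h3 (hk j (by omega))
      rw [hzs]
      exact ⟨hψ1 h5, h4.trans ((hstep _ h3).trans (hψ3 _ h5))⟩
  by_cases hex : ∃ j, g (φ (z j)) = C.vertex (M + l)
  · right
    obtain ⟨h3, h4⟩ := hmem (Nat.find hex) fun k hk => Nat.find_min hex hk
    refine ⟨_, h3, h4, ?_⟩
    have h5 := hstep _ h3
    rw [Nat.find_spec hex, Nat.add_right_comm] at h5
    exact h5
  · left
    push Not at hex
    have hz : ∀ j, z j ∈ C.offNeighbours (i + 1) := fun j => (hmem j fun k _ => hex k).1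
    have hcancel : ∀ a b, z (a + 1) = z (b + 1) → z a = z b := by
      intro a b hab
      rw [hzs, hzs] at hab
      exact hφ2 (hz a) (hz b) (g.injective
        (hψ2 (hoff _ (hz a) (hex a)) (hoff _ (hz b) (hex b)) hab))
    -- The orbit never returns to its start: that would put `x_M` in the image of `φ`, which
    -- consists of neighbours off the ray.
    have hne : ∀ a, z 0 ≠ z (a + 1) := by
      intro a ha
      rw [hzs] at ha
      have h3 := g.injective (hψ2 h.vertex_mem_off (hoff _ (hz a) (hex a)) ha)
      refine (hφ1 (hz a)).2 (Or.inr ⟨M, rfl, h3.symm⟩)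
    refine ⟨z, ?_, hz, hemb0, fun j => ?_⟩
    · intro a
      induction a with
      | zero =>
        intro b hab
        cases b with
        | zero => rfl
        | succ b => exact absurd hab (hne b)
      | succ a ih =>
        intro b hab
        cases b with
        | zero => exact absurd hab.symm (hne a)
        | succ b => rw [ih (hcancel a b hab)]
    · rw [hzs]
      exact (hstep _ (hz j)).trans (hψ3 _ (hoff _ (hz j) (hex j)))

theorem emb_back_piece_of_chain (hT : T.IsTree) {C : Ray T} {i : ℕ} {z : ℕ → V}
    (hinj : Function.Injective z) (hz : ∀ j, z j ∈ C.offNeighbours (i + 1))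
    (h0 : Emb T (C.back i) (C.vertex i) (half T (C.vertex (i + 1)) (z 0)) (z 0))
    (h : ∀ j, Emb T (half T (C.vertex (i + 1)) (z j)) (z j)
        (half T (C.vertex (i + 1)) (z (j + 1))) (z (j + 1))) :
    Emb T (C.back (i + 1)) (C.vertex (i + 1)) (C.piece (i + 1)) (C.vertex (i + 1)) := by
  have hne : ∀ j, C.vertex i ≠ z j := fun j hj => (hz j).2 (Or.inr ⟨i, rfl, hj.symm⟩)
  refine C.emb_back_piece hT (F := fun n => n.casesOn (C.vertex i) z) rfl hz ?_ ?_
  · intro a b hab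
    cases a with
    | zero =>
      cases b with
      | zero => rfl
      | succ b => exact absurd hab (hne b)
    | succ a =>
      cases b with
      | zero => exact absurd hab.symm (hne a)
      | succ b => rw [hinj hab]
  · intro j
    cases j with
    | zero => exact h0
    | succ j => exact h j

/-- Fix a failure index `i`. An infinite ascending chain of off-ray branches at `x_{i+1}` above
`back i` is impossible, so each later failure gives instead a branch at `x_{i+1}` lying between two
later parts `back n` and `back m`. Since these parts increase strictly along the residue class,
interleaving them yields distinct branches that form exactly such a chain. -/
theorem exists_preserved_tail_of_shift (hT : T.IsTree) {C : Ray T} (hreg : C.IsRegular)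
    (hC : ∀ f : T ↪g T, ∃ l, C.ShiftedBy f l) {f₀ : T ↪g T} {k : ℕ} (hk : 0 < k)
    (hf₀ : C.ShiftedBy f₀ k) : ∃ N, ∀ f : T ↪g T, (C.tail N).PreservedBy f := by
  classical
  by_contra! hcon
  have hfail : ∀ K, ∃ M, K ≤ M ∧ ∃ g l, C.LastFailure g l M := by
    intro K
    obtain ⟨g, hg⟩ := hcon K
    obtain ⟨l, hl⟩ := hC g
    obtain ⟨M, hM, hM'⟩ := exists_lastFailure hl hg
    exact ⟨M, hM, g, l, hM'⟩
  obtain ⟨r, hr⟩ := exists_frequently_fiber (fun n => n % k) (Finset.range k)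
    (fun n => Finset.mem_range.2 (Nat.mod_lt n hk)) hfail
  obtain ⟨F, hF⟩ := hreg
  have hF' : ∀ i, ∃ j ∈ F, C.PieceEmb i j ∧ C.PieceEmb j i := by
    intro i
    obtain ⟨j, hj, h1, h2⟩ := hF i
    exact ⟨j, hj, h1.emb hT, h2.emb hT⟩
  have prefl := PieceEmb.refl C
  have ptrans : ∀ {a b c}, C.PieceEmb a b → C.PieceEmb b c → C.PieceEmb a c :=
    fun h1 h2 => Emb.trans h1 h2
  have brefl := BackEmb.refl C
  have btrans : ∀ {a b c}, C.BackEmb a b → C.BackEmb b c → C.BackEmb a c :=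
    fun h1 h2 => Emb.trans h1 h2
  obtain ⟨N₀, hN₀⟩ := hf₀.exists_emb hT
  obtain ⟨N₁, hN₁⟩ := exists_periodic prefl ptrans hF' hk fun n hn => (hN₀ n hn).2
  let N := max N₀ N₁
  have hper : ∀ n, N ≤ n → C.PieceEmb n (n + k) ∧ C.PieceEmb (n + k) n :=
    fun n hn => hN₁ n (by omega)
  have hpl : ∀ {g l}, C.ShiftedBy g l → ∀ n, N ≤ n → C.PieceEmb n (n + l) ∧ C.PieceEmb (n + l) n := by
    intro g l hg n hn
    obtain ⟨K, hK⟩ := hg.exists_emb hT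
    exact periodic_of_eventually prefl ptrans hk hper (fun n hn => (hK n hn).2) hn
  have hpt : ∀ t n, N ≤ n → C.PieceEmb n (n + t * k) ∧ C.PieceEmb (n + t * k) n := by
    intro t n hn
    refine ⟨chain_of_step prefl ptrans (fun n hn => (hper n hn).1) t hn, ?_⟩
    exact chain_of_step (E := fun a b => C.PieceEmb b a) prefl (fun h1 h2 => ptrans h2 h1)
      (fun n hn => (hper n hn).2) t hn
  have hbt : ∀ t n, N ≤ n → C.BackEmb n (n + t * k) := fun t n hn =>
    chain_of_step brefl btrans (fun n hn => (hN₀ n hn).1) t (by omega)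
  have hstar : ∀ t n, N ≤ n → 0 < t → ¬ C.BackEmb (n + t * k) n := fun t n hn ht =>
    not_backEmb hT hC (Nat.mul_pos ht hk) fun m hm => (hpt t m (by omega)).2
  have hdiff : ∀ {a b}, a ≤ b → a % k = r → b % k = r → ∃ t, b = a + t * k := by
    intro a b hab ha hb
    obtain ⟨t, ht⟩ := (Nat.modEq_iff_dvd' hab).1 (ha.trans hb.symm)
    exact ⟨t, by rw [mul_comm, ← ht]; omega⟩
  have hback : ∀ {a b}, N ≤ a → a ≤ b → a % k = r → b % k = r → C.BackEmb a b := by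
    intro a b hNa hab ha hb
    obtain ⟨t, rfl⟩ := hdiff hab ha hb
    exact hbt t a hNa
  -- The margin `k` keeps `i + 1 - k` in the periodic range, where `back (i + 1)` would be sent.
  obtain ⟨i, hi, -, hir⟩ := hr (N + k)
  have hotel : ∀ z : ℕ → V, Function.Injective z → (∀ j, z j ∈ C.offNeighbours (i + 1)) →
      Emb T (C.back i) (C.vertex i) (half T (C.vertex (i + 1)) (z 0)) (z 0) →
      ¬ ∀ j, Emb T (half T (C.vertex (i + 1)) (z j)) (z j)
        (half T (C.vertex (i + 1)) (z (j + 1))) (z (j + 1)) := by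
    intro z h1 h2 h3 h4
    have h5 := emb_back_piece_of_chain hT h1 h2 h3 h4
    have h6 := (hpt 1 (i + 1 - k) (by omega)).2
    have e : i + 1 - k + 1 * k = i + 1 := by omega
    refine hstar 1 (i + 1 - k) (by omega) one_pos ?_
    rw [e] at h6 ⊢
    exact h5.trans (h6.trans (Emb.of_subset (C.piece_subset_back hT _) _))
  have hbetween : ∀ n, ∃ D m, i ≤ n → n % k = r → D ∈ C.offNeighbours (i + 1) ∧ n ≤ m ∧ m % k = r ∧
      Emb T (C.back n) (C.vertex n) (half T (C.vertex (i + 1)) D) D ∧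
      Emb T (half T (C.vertex (i + 1)) D) D (C.back m) (C.vertex m) := by
    intro n
    by_cases hn : i ≤ n ∧ n % k = r
    swap
    -- Arbitrary values for indices outside the residue class, only to make the choice total.
    · exact ⟨C.vertex 0, 0, fun h1 h2 => absurd ⟨h1, h2⟩ hn⟩
    obtain ⟨M, hM, ⟨g, l, hg⟩, hMr⟩ := hr n
    have hnM : C.BackEmb n M := hback (by omega) hM hn.2 hMr
    have hgl : C.ShiftedBy g l := ⟨M + 1, fun n hn => hg.1 n hn⟩
    obtain ⟨t, ht⟩ := hdiff (hn.1.trans hM) hir hMr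
    have hpp := hpt t (i + 1) (by omega)
    have e : i + 1 + t * k = M + 1 := by omega
    rw [e] at hpp
    rcases hg.chain_or_between hT hpp.1 (ptrans (hpl hgl (M + 1) (by omega)).2 hpp.2) with
      ⟨z, h1, h2, h3, h4⟩ | ⟨D, h1, h2, h3⟩
    · exact absurd h4 (hotel z h1 h2 (Emb.trans (hback (by omega) (by omega) hir hMr) h3))
    -- The index `M + l` may leave the residue class; repeating the shift up to `M + k * l` returns
    -- to it.
    · refine ⟨D, M + k * l, fun _ _ => ⟨h1, by omega, ?_, Emb.trans hnM h2, h3.trans ?_⟩⟩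
      · rw [Nat.add_mul_mod_self_left]
        exact hMr
      · rcases Nat.eq_zero_or_pos l with rfl | hl
        · exact brefl _
        · obtain ⟨k', rfl⟩ := Nat.exists_eq_add_of_le' hk
          have h4 := chain_of_step brefl btrans (N := M + 1)
            (fun n hn => backEmb_of_shift hT hg.1 hn) k' (n := M + l) (by omega)
          have e : M + l + k' * l = M + (k' + 1) * l := by ring
          rwa [e] at h4
  choose D μ hD using hbetween
  -- Restarting at `m j + k` rather than `m j` forces a strict increase between the upper bound of
  -- one branch and the lower bound of the next.
  let m : ℕ → ℕ := fun j => (fun n => μ (n + k))^[j] i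
  have hms : ∀ j, m (j + 1) = μ (m j + k) := fun j => Function.iterate_succ_apply' _ j _
  have hm : ∀ j, i ≤ m j ∧ m j % k = r := by
    intro j
    induction j with
    | zero => exact ⟨le_rfl, hir⟩
    | succ j ih =>
      obtain ⟨-, h1, h2, -, -⟩ := hD (m j + k) (by omega) (by rw [Nat.add_mod_right]; exact ih.2)
      rw [hms]
      exact ⟨by omega, h2⟩
  have hmk : ∀ j, i ≤ m j + k ∧ (m j + k) % k = r := fun j =>
    ⟨by have := (hm j).1; omega, by rw [Nat.add_mod_right]; exact (hm j).2⟩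
  have hDj := fun j => hD (m j + k) (hmk j).1 (hmk j).2
  have hmono : Monotone m := monotone_nat_of_le_succ fun j => by
    have := (hDj j).2.1
    rw [hms]
    omega
  have hup : ∀ j, Emb T (half T (C.vertex (i + 1)) (D (m j + k))) (D (m j + k))
      (C.back (m (j + 1))) (C.vertex (m (j + 1))) := fun j => by
    rw [hms]
    exact (hDj j).2.2.2.2
  -- A repeated branch would embed a later origin part into an earlier one of the same residue.
  have hlt : ∀ a b, a < b → D (m a + k) ≠ D (m b + k) := by
    intro a b hab heq
    have h1 := (hDj b).2.2.2.1
    rw [← heq] at h1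
    have h2 : C.BackEmb (m b + k) (m (a + 1)) := h1.trans (hup a)
    have h3 := hmono (Nat.succ_le_of_lt hab)
    obtain ⟨t, ht⟩ := hdiff h3 (hm (a + 1)).2 (hm b).2
    have h4 := hm (a + 1)
    refine hstar (t + 1) (m (a + 1)) (by omega) (Nat.succ_pos t) ?_
    have e : m (a + 1) + (t + 1) * k = m b + k := by rw [ht]; ring
    rwa [e]
  refine hotel (fun j => D (m j + k)) ?_ (fun j => (hDj j).1) ?_ fun j => ?_
  · intro a b hab
    rcases lt_trichotomy a b with h1 | h1 | h1
    · exact absurd hab (hlt a b h1)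
    · exact h1
    · exact absurd hab.symm (hlt b a h1)
  · have := hmk 0
    exact Emb.trans (hback (by omega) this.1 hir this.2) (hDj 0).2.2.2.1
  · refine (hup j).trans (Emb.trans (hback ?_ ?_ (hm (j + 1)).2 (hmk (j + 1)).2)
      (hDj (j + 1)).2.2.2.1)
    · have := (hm (j + 1)).1
      omega
    · omega

/-! ### Regular ends of scattered trees which are fixed by all embeddings -/

/-- A failing embedding fixes `x_{M+1}` and throws `back M` into a branch off the ray. Two earlier
vertices with pieces equimorphic to that of `x_{M+1}` receive this branch too, so `back M` contains
two copies of itself pointing away from `x_M`; composing them along words gives a binary tree. -/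
theorem exists_preserved_tail_of_isScattered (hT : T.IsTree) (hs : IsScattered T) {C : Ray T}
    (hreg : C.IsRegular) (hC : ∀ f : T ↪g T, C.ShiftedBy f 0) :
    ∃ N, ∀ f : T ↪g T, (C.tail N).PreservedBy f := by
  by_contra! hcon
  have hfail : ∀ K, ∃ M, K ≤ M ∧ ∃ g, C.LastFailure g 0 M := by
    intro K
    obtain ⟨g, hg⟩ := hcon K
    obtain ⟨M, hM, hM'⟩ := exists_lastFailure (hC g) hg
    exact ⟨M, hM, g, hM'⟩
  obtain ⟨F, hF⟩ := hreg
  choose ρ hρ hρ1 hρ2 using hF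
  obtain ⟨c, hc⟩ := exists_frequently_fiber (fun n => ρ (n + 1)) F (fun n => hρ (n + 1)) hfail
  obtain ⟨M₁, -, -, hc₁⟩ := hc 0
  obtain ⟨M₂, h12, -, hc₂⟩ := hc (M₁ + 1)
  obtain ⟨M, h23, ⟨g, hg⟩, hc₃⟩ := hc (M₂ + 1)
  have copy : ∀ a, ρ (a + 1) = c → a + 1 ≤ M → ∃ y ∈ C.offNeighbours (a + 1), ∃ p : V → V,
      IsoOn T (C.back M) p ∧ Set.MapsTo p (C.back M) (half T (C.vertex (a + 1)) y) ∧
      p (C.vertex M) = y ∧ Set.MapsTo p (C.back M) (C.back M) ∧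
      ∀ v ∈ C.back M, T.dist (C.vertex M) (p v) = M - (a + 1) + 1 + T.dist (C.vertex M) v := by
    intro a hρa haM
    have hE : C.PieceEmb (M + 1 + 0) (a + 1) :=
      ((hρ1 (M + 1)).emb hT).trans ((hc₃.trans hρa.symm) ▸ (hρ2 (a + 1)).emb hT)
    obtain ⟨φ, h1, -, h2⟩ := C.exists_branch_map hT hE
    have h3 := (hg.emb_half hT (C.vertex M)).trans (h2 _ hg.vertex_mem_off)
    have hy := h1 hg.vertex_mem_off
    obtain ⟨p, hp1, hp2, hp3⟩ := h3
    have hr : ∀ y ∈ C.offNeighbours (a + 1), C.vertex M ∈ half T y (C.vertex (a + 1)) := by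
      intro y hy
      rcases haM.eq_or_lt with h4 | h4
      · rw [← h4]
        exact left_mem_half hy.1
      · refine half_subset hT (C.adj (a + 1)) hy.1 (fun h5 => hy.2 (Or.inl h5.symm)) ?_
        exact C.vertex_mem_front_of_lt hT h4
    refine ⟨_, hy, p, hp1, hp2, hp3, fun v hv => ?_, fun v hv => ?_⟩
    · exact C.back_mono hT haM (C.half_subset_back hT hy.1 (fun h => hy.2 (Or.inl h)) (hp2 hv))
    · have h4 := dist_add_dist hT hy.1 (hr _ hy) (hp2 hv)
      have h5 := hp1 _ (C.vertex_mem_back M) v hv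
      rw [hp3] at h5
      rw [h4, h5, SimpleGraph.dist_comm (u := C.vertex M) (v := C.vertex (a + 1)),
        C.dist_vertex hT haM]
  obtain ⟨y, hy, p, hp1, hp2, hp3, hp4, hp5⟩ := copy M₁ hc₁ (by omega)
  obtain ⟨y', hy', q, hq1, hq2, hq3, hq4, hq5⟩ := copy M₂ hc₂ (by omega)
  have hr := C.vertex_mem_back M
  have hyy' : T.dist y y' = M₂ - M₁ + 2 := by
    have h1 := C.dist_back_front hT (C.piece_subset_back hT _ (C.mem_piece_of_off hT hy))
      ((C.mem_piece_succ hT).1 (C.mem_piece_of_off hT hy')).2 (by omega)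
    rw [dist_adj hy.1.symm, dist_adj hy'.1] at h1
    omega
  have hpr := hp5 _ hr
  have hqr := hq5 _ hr
  rw [SimpleGraph.dist_self] at hpr hqr
  -- Roots of all self-copies of `back M` that point away from `x_M`; the additive distance formula
  -- is what survives composition with `p` and `q`.
  let G : Set V := {s | ∃ w : V → V, IsoOn T (C.back M) w ∧ Set.MapsTo w (C.back M) (C.back M) ∧
    w (C.vertex M) = s ∧
    ∀ v ∈ C.back M, T.dist (C.vertex M) (w v) = T.dist (C.vertex M) s + T.dist (C.vertex M) v}
  refine not_isScattered_of_branching hT (C.vertex M) (G := G)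
    ⟨C.vertex M, id, fun _ _ _ _ => rfl, Set.mapsTo_id _, rfl, fun v _ => by
      rw [SimpleGraph.dist_self, zero_add]; rfl⟩ ?_ hs
  rintro _ ⟨w, h1, h2, rfl, h3⟩
  have hwp := h3 _ (hp4 hr)
  have hwq := h3 _ (hq4 hr)
  have hwpr := h1 _ hr _ (hp4 hr)
  have hwqr := h1 _ hr _ (hq4 hr)
  have hwpq := h1 _ (hp4 hr) _ (hq4 hr)
  rw [hp3] at hpr hwp hwpr hwpq
  rw [hq3] at hqr hwq hwqr hwpq
  have hwqp := hwpq
  rw [SimpleGraph.dist_comm (u := w y)] at hwqp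
  refine ⟨w y, ⟨w ∘ p, h1.mono subset_rfl |> hp1.comp hp4, h2.comp hp4, congrArg w hp3,
    fun v hv => ?_⟩, w y', ⟨w ∘ q, h1.mono subset_rfl |> hq1.comp hq4, h2.comp hq4,
    congrArg w hq3, fun v hv => ?_⟩, ?_, ?_, ?_, ?_⟩
  · have h4 := h3 _ (hp4 hv)
    have h5 := hp5 v hv
    rw [Function.comp_apply]
    omega
  · have h4 := h3 _ (hq4 hv)
    have h5 := hq5 v hv
    rw [Function.comp_apply]
    omega
  -- The distances from `x_M` to `y` and `y'` differ by `M₂ - M₁`, while `y` and `y'` are `M₂ - M₁ +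
  -- 2` apart. The extra `2` makes the copies incomparable.
  all_goals rw [Below]; omega

end Ray

/-- A regular end which is preserved forward by every embedding contains a ray preserved by every
embedding, if the tree is scattered or the end is not almost rigid. -/
theorem exists_preserved_ray (hT : T.IsTree) {e : TreeEnd T} (hreg : e.IsRegular)
    (hf : ∀ f : T ↪g T, e.PreservedForwardBy f) (h : IsScattered T ∨ ¬ e.IsAlmostRigid) :
    ∃ C : Ray T, C.toEnd = e ∧ ∀ f : T ↪g T, C.PreservedBy f := by
  obtain ⟨C, rfl, hC⟩ := hreg
  have hshift : ∀ f : T ↪g T, ∃ l, C.ShiftedBy f l := fun f => C.exists_shiftedBy hT (hf f)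
  suffices hN : ∃ N, ∀ f : T ↪g T, (C.tail N).PreservedBy f by
    obtain ⟨N, hN⟩ := hN
    exact ⟨C.tail N, C.toEnd_tail N, hN⟩
  by_cases hpos : ∃ f k, 0 < k ∧ C.ShiftedBy f k
  · obtain ⟨f, k, hk, hfk⟩ := hpos
    exact Ray.exists_preserved_tail_of_shift hT hC hshift hk hfk
  have hzero : ∀ f : T ↪g T, C.ShiftedBy f 0 := by
    intro f
    obtain ⟨l, hl⟩ := hshift f
    rcases Nat.eq_zero_or_pos l with rfl | hl'
    · exact hl
    · exact absurd ⟨f, l, hl', hl⟩ hpos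
  rcases h with hs | hr
  · exact Ray.exists_preserved_tail_of_isScattered hT hs hC hzero
  -- An embedding that fixes a tail pointwise preserves the end backward as well.
  · refine absurd (fun f => ⟨?_, hf f⟩) hr
    obtain ⟨N, hN⟩ := hzero f
    refine ⟨C.tail N, C.toEnd_tail N, ?_⟩
    rintro _ ⟨n, rfl⟩
    exact ⟨_, ⟨n, rfl⟩, hN (N + n) (Nat.le_add_right N n)⟩

end TreeEmb

theorem theorem1p3 {V : Type u} (T : SimpleGraph V) (hT : T.IsTree) :
    (TreeEmb.IsScattered T →
      ∀ e : TreeEmb.TreeEnd T, e.HasMaximalOrder →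
        (∀ e' : TreeEmb.TreeEnd T, e'.HasMaximalOrder → e' = e) →
          ∀ f : T ↪g T, e.PreservedForwardBy f) ∧
    (∀ e : TreeEmb.TreeEnd T, e.IsRegular → (∀ f : T ↪g T, e.PreservedForwardBy f) →
      (TreeEmb.IsScattered T ∨ ¬ e.IsAlmostRigid) →
        ∃ C : TreeEmb.Ray T, C.toEnd = e ∧ ∀ f : T ↪g T, C.PreservedBy f) :=
  ⟨fun hs _ he hu f => TreeEmb.preservedForwardBy_of_unique_maximal hT hs he hu f,
    fun _ hreg hf h => TreeEmb.exists_preserved_ray hT hreg hf h⟩
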